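/- Let $n\ge 1$, let $h,a_1,\dots,a_n$ be holomorphic functions in a neighbourhood of $0\in\mathbb C^n$ such that $a_1(0)=\dots=a_n(0)=0$ and $0$ is an isolated common zero of $a_1,\dots,a_n$. Consider the residue form $$\omega=\frac{h\,dz_1\wedge\dots\wedge dz_n}{a_1a_2\cdots a_n}.$$ Its Grothendieck residue $\operatorname{Res}(\omega)\in\mathbb C$ is defined as follows. On a small polydisc $U$ about $0$, the form $\omega$, regarded as an alternating Čech cocycle for the cover of $U\setminus\{0\}$ by the sets $\{a_i\neq0\}$, $i=1,\dots,n$, defines a class in the local cohomology group $H^n_{\{0\}}(U,\Omega^n)$. This class is represented by a Čech cocycle $\beta$ for the cover of $U\setminus\{0\}$ by the sets $\{z_i\ne0\}$ (the two cocycles become cohomologous on the common refinement of the two covers), and $\operatorname{Res}(\omega)=(2\pi i)^{-n}\int_{|z_1|=r_1,\dots,|z_n|=r_n}\beta_{1\cdots n}$ for small $r_i>0$; here, for $n=1$, cocycles are taken modulo forms holomorphic on $U$. Suppose that $\omega$ is flaglike, i.e. for each $i$ the function $a_i$ depends only on $z_1,\dots,z_i$ near $0$. Then $\operatorname{Res}(\omega)$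 exists and is well defined, the iterated residue $\operatorname{Res}_{z_n}\cdots\operatorname{Res}_{z_1}\omega$ exists, and $$\operatorname{Res}(\omega)=\operatorname{Res}_{z_n}\cdots\operatorname{Res}_{z_1}\,\omega .$$ Here $\operatorname{Res}_{z_i}$ is the ordinary one-variable residue at $z_i=0$, taken with $z_{i+1},\dots,z_n$ regarded as constants (the residues in $z_1,\dots,z_{i-1}$ having been taken before); the constants range over all small nonzero $z_n$, then all small nonzero $z_{n-1}$ (depending on $z_n$), and so on down to $z_{i+1}$, and for such constants the function of $z_i$ is holomorphic in a punctured neighbourhood of $0$. -/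

import Mathlib

open Filter Topology

noncomputable section

namespace ResidueForm

/-! ### Cech cochains

Holomorphic `n`-forms on an open subset of `ℂⁿ` are written `f dz₁ ∧ ⋯ ∧ dzₙ` and identified with
their coefficient `f`.  For an open set `U`, a point `0 ∈ U` and a family of open sets `V i` covering
`U \ {0}`, a cochain on `p`-tuples assigns to each `s : Fin p → ι` a holomorphic form on the
intersection of the `V (s k)`.  The value on the empty tuple (`p = 0`) is a form on `U`
itself, so that the cohomology at `p`-tuples is the `p`-th local cohomology with support in `0`. -/

/-- The intersection `U ∩ V (s 0) ∩ ⋯ ∩ V (s (p - 1))`. -/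
def cechInter {E ι : Type*} (U : Set E) (V : ι → Set E) {p : ℕ} (s : Fin p → ι) : Set E :=
  {z | z ∈ U ∧ ∀ k, z ∈ V (s k)}

/-- `c` is a Cech cochain on `p`-tuples with holomorphic values. -/
def IsCechCochain {m : ℕ} {ι : Type*} (U : Set (Fin m → ℂ)) (V : ι → Set (Fin m → ℂ)) {p : ℕ}
    (c : (Fin p → ι) → (Fin m → ℂ) → ℂ) : Prop :=
  ∀ s, DifferentiableOn ℂ (c s) (cechInter U V s)

/-- The Cech differential. -/
def cechD {m : ℕ} {ι : Type*} {p : ℕ} (c : (Fin p → ι) → (Fin m → ℂ) → ℂ)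
    (s : Fin (p + 1) → ι) (z : Fin m → ℂ) : ℂ :=
  ∑ k : Fin (p + 1), (-1 : ℂ) ^ (k : ℕ) * c (fun j => s (k.succAbove j)) z

/-- `c` is a Cech cocycle on `p`-tuples. -/
def IsCechCocycle {m : ℕ} {ι : Type*} (U : Set (Fin m → ℂ)) (V : ι → Set (Fin m → ℂ)) {p : ℕ}
    (c : (Fin p → ι) → (Fin m → ℂ) → ℂ) : Prop :=
  IsCechCochain U V c ∧ ∀ s : Fin (p + 1) → ι, ∀ z ∈ cechInter U V s, cechD c s z = 0

/-- The cochains `α` for the cover `V` and `β` for the cover `W` become cohomologous on the common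
refinement `V i ∩ W j` of the two covers. -/
def CechCohomologous {m : ℕ} {ι κ : Type*} (U : Set (Fin m → ℂ))
    (V : ι → Set (Fin m → ℂ)) (W : κ → Set (Fin m → ℂ)) {p : ℕ}
    (α : (Fin (p + 1) → ι) → (Fin m → ℂ) → ℂ) (β : (Fin (p + 1) → κ) → (Fin m → ℂ) → ℂ) : Prop :=
  ∃ γ : (Fin p → ι × κ) → (Fin m → ℂ) → ℂ,
    IsCechCochain U (fun q : ι × κ => V q.1 ∩ W q.2) γ ∧
    ∀ s : Fin (p + 1) → ι × κ, ∀ z ∈ cechInter U (fun q : ι × κ => V q.1 ∩ W q.2) s,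
      α (fun k => (s k).1) z - β (fun k => (s k).2) z = cechD γ s z

/-! ### Residue forms -/

/-- The residue form `h dz / (a₁ ⋯ aₙ)` at `0`: `h` and the `aᵢ` are germs of holomorphic functions
at `0`, and `0` is an isolated common zero of the `aᵢ`, so that the open sets `{aᵢ ≠ 0}`
form a cover of a punctured neighbourhood of `0`. -/
structure IsResidueForm {m : ℕ} (h : (Fin m → ℂ) → ℂ) (a : Fin m → (Fin m → ℂ) → ℂ) : Prop where
  analyticAt_num : AnalyticAt ℂ h 0
  analyticAt_den : ∀ i, AnalyticAt ℂ (a i) 0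
  den_zero : ∀ i, a i 0 = 0
  isolated : ∀ᶠ z in 𝓝[≠] (0 : Fin m → ℂ), ∃ i, a i z ≠ 0

/-- Near `0`, the function `aᵢ` depends only on `z₁, …, zᵢ`. -/
def IsFlaglike {m : ℕ} (a : Fin m → (Fin m → ℂ) → ℂ) : Prop :=
  ∀ i, ∃ U ∈ 𝓝 (0 : Fin m → ℂ), ∀ z ∈ U, ∀ w ∈ U, (∀ j, j ≤ i → z j = w j) → a i z = a i w

/-- The coefficient `h / (a₁ ⋯ aₙ)` of the form. -/
def coeff {m : ℕ} (h : (Fin m → ℂ) → ℂ) (a : Fin m → (Fin m → ℂ) → ℂ) (z : Fin m → ℂ) : ℂ :=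
  h z / ∏ i, a i z

/-- The cover `{aᵢ ≠ 0}`. -/
def denCover {m : ℕ} (a : Fin m → (Fin m → ℂ) → ℂ) (i : Fin m) : Set (Fin m → ℂ) :=
  {z | a i z ≠ 0}

/-- The cover `{zᵢ ≠ 0}`. -/
def coordCover (m : ℕ) (i : Fin m) : Set (Fin m → ℂ) :=
  {z | z i ≠ 0}

/-- The alternating Cech cochain for the cover `{aᵢ ≠ 0}` whose value on `(1, …, n)` is the form
`h dz / (a₁ ⋯ aₙ)`; the determinant is the sign of `s` if `s` is a permutation and `0` otherwise. -/
def formCochain {m : ℕ} (h : (Fin m → ℂ) → ℂ) (a : Fin m → (Fin m → ℂ) → ℂ)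
    (s : Fin m → Fin m) (z : Fin m → ℂ) : ℂ :=
  (Matrix.of fun k l : Fin m => if s k = l then (1 : ℂ) else 0).det * coeff h a z

/-- `ρ` is the Grothendieck residue at `0` of the residue form `h dz / (a₁ ⋯ aₙ)`, where `n = p + 1`:
on some polydisc `U` about `0` (a ball for the sup norm), the local cohomology class of
the form, given by its Cech cocycle for the cover `{aᵢ ≠ 0}` of `U \ {0}`, is also represented by
a cocycle `β` for the cover `{zᵢ ≠ 0}`, and `ρ` is the coefficient of
`dz / (z₁ ⋯ zₙ)` in the Laurent expansion of `β`, i.e. `(2πi)⁻ⁿ` times its integral over a torus. -/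
def IsLocalResidue {p : ℕ} (h : (Fin (p + 1) → ℂ) → ℂ)
    (a : Fin (p + 1) → (Fin (p + 1) → ℂ) → ℂ) (ρ : ℂ) : Prop :=
  ∃ δ : ℝ, 0 < δ ∧
    DifferentiableOn ℂ h (Metric.ball 0 δ) ∧
    (∀ i, DifferentiableOn ℂ (a i) (Metric.ball 0 δ)) ∧
    (∀ z ∈ Metric.ball (0 : Fin (p + 1) → ℂ) δ, (∀ i, a i z = 0) ↔ z = 0) ∧
    ∃ β : (Fin (p + 1) → Fin (p + 1)) → (Fin (p + 1) → ℂ) → ℂ,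
      IsCechCocycle (Metric.ball 0 δ) (coordCover (p + 1)) β ∧
      CechCohomologous (Metric.ball 0 δ) (denCover a) (coordCover (p + 1)) (formCochain h a) β ∧
      ∀ R : Fin (p + 1) → ℝ, (∀ i, 0 < R i ∧ R i < δ) →
        ρ = (2 * Real.pi * Complex.I : ℂ)⁻¹ ^ (p + 1) * torusIntegral (β id) 0 R

/-- The Grothendieck residue at `0` of `h dz / (a₁ ⋯ aₙ)`. -/
def localResidue {p : ℕ} (h : (Fin (p + 1) → ℂ) → ℂ)
    (a : Fin (p + 1) → (Fin (p + 1) → ℂ) → ℂ) : ℂ :=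
  Classical.epsilon (IsLocalResidue h a)

/-! ### Iterated residues -/

/-- `f` is holomorphic in a punctured neighbourhood of `c`. -/
def HasIsolatedSingularity (f : ℂ → ℂ) (c : ℂ) : Prop :=
  ∀ᶠ t in 𝓝[≠] c, DifferentiableAt ℂ f t

/-- The ordinary residue at `c` of a function of one variable holomorphic in a punctured
neighbourhood of `c`: `(2πi)⁻¹` times its integral over any small circle about `c`
(the integral does not depend on the radius once this is small). -/
def residue (f : ℂ → ℂ) (c : ℂ) : ℂ :=
  limUnder (𝓝[>] (0 : ℝ)) fun r : ℝ => (2 * Real.pi * Complex.I : ℂ)⁻¹ * circleIntegral f c r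

/-- `Res_{z_n} ⋯ Res_{z_1}` at `0`: the residue in the first variable is taken first,
for constant values of the other variables; the result is a function of the
remaining variables, to which the same is applied. -/
def iteratedResidue : (m : ℕ) → ((Fin m → ℂ) → ℂ) → ℂ
  | 0, F => F Fin.elim0
  | m + 1, F => iteratedResidue m fun w => residue (fun t => F (Fin.cons t w)) 0

/-- `P (z₁, …, zₘ)` holds for all sufficiently small nonzero `zₘ`, then all sufficiently small nonzero
`z_{m-1}` (depending on `zₘ`), and so on down to `z₁`. -/
def NearFlag : (m : ℕ) → ((Fin m → ℂ) → Prop) → Prop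
  | 0, P => P Fin.elim0
  | m + 1, P => ∀ᶠ t in 𝓝[≠] (0 : ℂ), NearFlag m fun w => P (Fin.snoc (α := fun _ => ℂ) w t)

/-- Every one-variable residue occurring in the iterated residue makes sense:
at each step the function of the current variable has an isolated singularity at `0`
for the relevant constant values of the remaining variables. -/
def IteratedResidueExists : (m : ℕ) → ((Fin m → ℂ) → ℂ) → Prop
  | 0, _ => True
  | m + 1, F =>
      (NearFlag m fun w => HasIsolatedSingularity (fun t => F (Fin.cons t w)) 0) ∧
      IteratedResidueExists m fun w => residue (fun t => F (Fin.cons t w)) 0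

end ResidueForm

end

noncomputable section

namespace ResidueForm

open MeasureTheory Metric Set

/-! ### Integrals over circles and tori -/

/-! Both residues equal one normalized torus integral of the form, over a torus adapted to the flag.
Since `0` is an isolated common zero, `aᵢ` cannot vanish identically on the `i`-th axis
(`eventually_single_ne_zero`). Choosing radii from the last variable to the first, each small
relative to the later ones, gives a polydisc on which `aᵢ` has no zero where `|zᵢ| = Rᵢ`
(`IsFlagSystem.exists_isFlagRadii`).

On such a torus two things happen. By Fubini with the `z₁`-integral innermost, the torus integral is
the iterated residue (`IsFlagSystem.iteratedResidue_eq`): for the other variables on their circles,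
the only singularity in `|z₁| ≤ R₁` is `z₁ = 0`. And a cocycle `β` in the class of the form differs
from it on `(1, …, n)` by a sum of terms, each missing one index `k` and hence holomorphic in `zₖ`
on the whole disc, so Cauchy's theorem kills them (`torusIntegral_eq_of_cechCohomologous`). This
gives the equality, and with it uniqueness of the residue.

Existence requires a representing `β`. Some power `zᵢ ^ Nᵢ` is a combination `∑ cᵢₗ aₗ`; the flag
structure gives this by induction on `i`, without the general Nullstellensatz (`exists_pow_eq_sum`).
The transformation law then suggests `h det(c) / ∏ zᵢ ^ Nᵢ`. That this is a cocycle, and is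
cohomologous to the form, follows from a single determinant identity and the prism homotopy of
simplicial topology (`sum_neg_one_pow_mul_det_eq_zero`, `sub_eq_sum_prism`, `exists_cocycle`). -/

theorem continuous_deriv_circleMap (c : ℂ) (r : ℝ) : Continuous (deriv (circleMap c r)) := by
  have : deriv (circleMap c r) = fun θ => circleMap 0 r θ * Complex.I := by
    ext θ
    simp
  rw [this]
  fun_prop

/-- Differentiation under the integral sign. Compactness of the circle gives a common ball of
parameters, and boundedness there supplies the dominating Lipschitz constant. -/
theorem differentiableAt_circleIntegral_of_eventually {m : ℕ} {F : ℂ → (Fin m → ℂ) → ℂ} {c : ℂ}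
    {r : ℝ} (hr : 0 ≤ r) {w₀ : Fin m → ℂ}
    (hF : ∀ t ∈ sphere c r, ∀ᶠ q in 𝓝 (t, w₀), DifferentiableAt ℂ (Function.uncurry F) q) :
    DifferentiableAt ℂ (fun w => ∮ t in C(c, r), F t w) w₀ := by
  set N : Set (ℂ × (Fin m → ℂ)) :=
    {q | ∀ᶠ q' in 𝓝 q, DifferentiableAt ℂ (Function.uncurry F) q'} with hN
  have hNo : IsOpen N := isOpen_setOfPred_eventually_nhds
  have hsub : sphere c r ×ˢ {w₀} ⊆ N := by
    rintro ⟨t, w⟩ ⟨ht, hw⟩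
    obtain rfl : w = w₀ := hw
    exact hF t ht
  obtain ⟨u, v, -, hv, hu', hv', huv⟩ :=
    generalized_tube_lemma (isCompact_sphere c r) isCompact_singleton hNo hsub
  obtain ⟨ε, hε, hεv⟩ := Metric.isOpen_iff.1 hv w₀ (hv' rfl)
  set ρ := ε / 2 with hρ
  have hρ0 : 0 < ρ := by positivity
  have hcb : closedBall w₀ ρ ⊆ v := (closedBall_subset_ball (by linarith)).trans hεv
  have hd : ∀ t ∈ sphere c r, ∀ w ∈ closedBall w₀ ρ,
      DifferentiableAt ℂ (Function.uncurry F) (t, w) := fun t ht w hw =>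
    (huv ⟨hu' ht, hcb hw⟩ : ∀ᶠ _ in _, _).self_of_nhds
  have hcont : ContinuousOn (Function.uncurry F) (sphere c r ×ˢ closedBall w₀ ρ) :=
    fun q hq => (hd q.1 hq.1 q.2 hq.2).continuousAt.continuousWithinAt
  obtain ⟨M, hM⟩ := ((isCompact_sphere c r).prod (isCompact_closedBall w₀ ρ)).exists_bound_of_continuousOn hcont
  have hds : ∀ t ∈ sphere c r, ∀ w ∈ closedBall w₀ ρ, DifferentiableAt ℂ (F t) w :=
    fun t ht w hw => (hd t ht w hw).comp w
      ((differentiableAt_const t).prodMk differentiableAt_id)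
  have hlip : ∀ t ∈ sphere c r, ∀ w ∈ ball w₀ ρ,
      ‖F t w - F t w₀‖ ≤ 2 * M / ρ * ‖w - w₀‖ := by
    intro t ht w hw
    rw [← dist_eq_norm, ← dist_eq_norm]
    -- Schwarz lemma: `F t` moves at most `2 * M` away from its value at `w₀` on the ball of radius
    -- `ρ`.
    refine Complex.dist_le_div_mul_dist_of_mapsTo_ball (R₁ := ρ) (R₂ := 2 * M)
      (fun w hw => (hds t ht w (ball_subset_closedBall hw)).differentiableWithinAt) ?_ hw
    intro w hw
    rw [mem_closedBall, dist_eq_norm]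
    have h1 := hM (t, w) ⟨ht, ball_subset_closedBall hw⟩
    have h2 := hM (t, w₀) ⟨ht, mem_closedBall_self hρ0.le⟩
    simp only [Function.uncurry] at h1 h2
    linarith [norm_sub_le (F t w) (F t w₀)]
  simp only [circleIntegral_def_Icc]
  have hmem : ∀ θ, circleMap c r θ ∈ sphere c r := circleMap_mem_sphere c hr
  have hcF : ∀ w ∈ ball w₀ ρ, Continuous fun θ => deriv (circleMap c r) θ • F (circleMap c r θ) w := by
    intro w hw
    refine (continuous_deriv_circleMap c r).smul ?_
    exact hcont.comp_continuous (f := fun θ => (circleMap c r θ, w)) (by fun_prop)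
      fun θ => ⟨hmem θ, ball_subset_closedBall hw⟩
  set F' : ℝ → ((Fin m → ℂ) →L[ℂ] ℂ) := fun θ => deriv (circleMap c r) θ •
    (fderiv ℂ (Function.uncurry F) (circleMap c r θ, w₀)).comp (ContinuousLinearMap.inr ℂ ℂ _)
  have hF' : Measurable fun θ : ℝ => fderiv ℂ (Function.uncurry F) (circleMap c r θ, w₀) :=
    (measurable_fderiv ℂ (Function.uncurry F)).comp
      ((continuous_circleMap c r).measurable.prodMk measurable_const)
  have : SecondCountableTopology (ℂ × (Fin m → ℂ) →L[ℂ] ℂ) := by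
    have : ProperSpace (ℂ × (Fin m → ℂ) →L[ℂ] ℂ) := FiniteDimensional.proper ℂ _
    infer_instance
  have hF'm : AEStronglyMeasurable F' (volume.restrict (Icc 0 (2 * Real.pi))) := by
    refine AEStronglyMeasurable.fun_smul (f := deriv (circleMap c r))
      (continuous_deriv_circleMap c r).aestronglyMeasurable ?_
    · exact ((ContinuousLinearMap.compL ℂ _ _ ℂ).flip
        (ContinuousLinearMap.inr ℂ ℂ (Fin m → ℂ))).continuous.comp_aestronglyMeasurable
        hF'.aestronglyMeasurable
  refine (hasFDerivAt_integral_of_dominated_loc_of_lip' (𝕜 := ℂ)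
    (bound := fun _ => r * (2 * M / ρ)) (F' := F')
    (ball_mem_nhds w₀ hρ0) (fun w hw => (hcF w hw).aestronglyMeasurable)
    ((hcF w₀ (mem_ball_self hρ0)).integrableOn_Icc) hF'm ?_ ?_ ?_).2.differentiableAt
  · refine Eventually.of_forall fun θ w hw => ?_
    rw [← smul_sub, norm_smul, mul_assoc]
    refine mul_le_mul (by simp [abs_of_nonneg hr]) (hlip _ (hmem θ) w hw) (norm_nonneg _) hr
  · exact (continuous_const).integrableOn_Icc
  · refine Eventually.of_forall fun θ => ?_
    have := (hd _ (hmem θ) w₀ (mem_closedBall_self hρ0.le)).hasFDerivAt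
    exact (this.comp w₀ (hasFDerivAt_prodMk_right _ _)).const_smul (deriv (circleMap c r) θ)

/-- The distinguished boundary `|zᵢ| = Rᵢ` of a polydisc about `0`. -/
def torus {m : ℕ} (R : Fin m → ℝ) : Set (Fin m → ℂ) := {z | ∀ i, ‖z i‖ = R i}

theorem torusMap_mem_torus {m : ℕ} {R : Fin m → ℝ} (hR : ∀ i, 0 ≤ R i) (θ : Fin m → ℝ) :
    torusMap 0 R θ ∈ torus R := fun i => by
  simp [torusMap, Complex.norm_exp_ofReal_mul_I, abs_of_nonneg (hR i)]

theorem continuous_torusMap {m : ℕ} (R : Fin m → ℝ) : Continuous (torusMap 0 R) := by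
  unfold torusMap
  fun_prop

theorem torusIntegrable_of_continuousOn {m : ℕ} {R : Fin m → ℝ} (hR : ∀ i, 0 ≤ R i)
    {f : (Fin m → ℂ) → ℂ} (hf : ContinuousOn f (torus R)) : TorusIntegrable f 0 R :=
  (hf.comp_continuous (continuous_torusMap R)
    (torusMap_mem_torus hR)).continuousOn.integrableOn_compact isCompact_Icc

theorem torusIntegral_congr {m : ℕ} {R : Fin m → ℝ} (hR : ∀ i, 0 ≤ R i)
    {f g : (Fin m → ℂ) → ℂ} (hfg : EqOn f g (torus R)) :
    torusIntegral f 0 R = torusIntegral g 0 R := by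
  unfold torusIntegral
  congr 1
  ext θ
  rw [hfg (torusMap_mem_torus hR θ)]

/-- Fubini for torus integrals, the integral over one coordinate being taken first. -/
theorem torusIntegral_eq_torusIntegral_circleIntegral {m : ℕ} {R : Fin (m + 1) → ℝ}
    (hR : ∀ i, 0 ≤ R i) {f : (Fin (m + 1) → ℂ) → ℂ} (hf : ContinuousOn f (torus R))
    (k : Fin (m + 1)) :
    torusIntegral f 0 R = torusIntegral (fun y => ∮ x in C(0, R k), f (k.insertNth x y)) 0
      (R ∘ k.succAbove) := by
  rw [torusIntegral_succAbove (torusIntegrable_of_continuousOn hR hf) k]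
  simp only [circleIntegral_def_Icc, torusIntegral, ← integral_smul]
  have h0 : (0 : Fin (m + 1) → ℂ) ∘ k.succAbove = 0 := rfl
  simp only [h0, Pi.zero_apply]
  rw [integral_integral_swap]
  · simp only [smul_eq_mul]
    congr 1
    ext θ
    congr 1
    ext x
    ring
  · rw [Measure.prod_restrict, ← Measure.volume_eq_prod]
    refine ContinuousOn.integrableOn_compact (isCompact_Icc.prod isCompact_Icc)
      (Continuous.continuousOn ?_)
    refine Continuous.smul ((continuous_deriv_circleMap 0 (R k)).comp continuous_fst)
      (Continuous.smul (f := fun q : ℝ × (Fin m → ℝ) =>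
        ∏ i, ((R ∘ k.succAbove) i : ℂ) * Complex.exp (q.2 i * Complex.I) * Complex.I)
        (by fun_prop) ?_)
    refine hf.comp_continuous ?_ ?_
    · refine Continuous.finInsertNth k (by fun_prop) ?_
      exact (continuous_torusMap _).comp continuous_snd
    · intro q i
      refine Fin.succAboveCases k ?_ (fun j => ?_) i
      · simp [abs_of_nonneg (hR k)]
      · simpa using torusMap_mem_torus (R := R ∘ k.succAbove) (fun i => hR _) q.2 j

/-! ### Flag systems of denominators -/

/-- The functions `aᵢ` are holomorphic on the polydisc of radius `δ`, where `aᵢ` depends only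
on `z₁, …, zᵢ`, and `aᵢ` vanishes on the `i`-th coordinate axis at most at `0`. -/
structure IsFlagSystem {m : ℕ} (δ : ℝ) (a : Fin m → (Fin m → ℂ) → ℂ) : Prop where
  differentiableOn : ∀ i, DifferentiableOn ℂ (a i) (ball 0 δ)
  eq_of_eq : ∀ i, ∀ z ∈ ball (0 : Fin m → ℂ) δ, ∀ w ∈ ball (0 : Fin m → ℂ) δ,
    (∀ j ≤ i, z j = w j) → a i z = a i w
  ne_zero : ∀ i t, t ≠ 0 → ‖t‖ < δ → a i (Pi.single i t) ≠ 0

/-- Radii of a torus such that `aᵢ` has no zeros on the part `|zᵢ| = Rᵢ` of the boundary of the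
polydisc. -/
structure IsFlagRadii {m : ℕ} (a : Fin m → (Fin m → ℂ) → ℂ) (R : Fin m → ℝ) : Prop where
  pos : ∀ i, 0 < R i
  ne_zero : ∀ z : Fin m → ℂ, (∀ j, ‖z j‖ ≤ R j) → ∀ i, ‖z i‖ = R i → a i z ≠ 0

theorem mem_ball_iff_forall {m : ℕ} {δ : ℝ} (hδ : 0 < δ) {z : Fin m → ℂ} :
    z ∈ ball (0 : Fin m → ℂ) δ ↔ ∀ i, ‖z i‖ < δ := by
  rw [mem_ball_zero_iff, pi_norm_lt_iff hδ]

theorem cons_mem_ball_iff {m : ℕ} {δ : ℝ} (hδ : 0 < δ) {t : ℂ} {w : Fin m → ℂ} :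
    (Fin.cons t w : Fin (m + 1) → ℂ) ∈ ball (0 : Fin (m + 1) → ℂ) δ ↔
      ‖t‖ < δ ∧ w ∈ ball (0 : Fin m → ℂ) δ := by
  simp [mem_ball_iff_forall hδ, Fin.forall_fin_succ]

theorem snoc_mem_ball_iff {m : ℕ} {δ : ℝ} (hδ : 0 < δ) {t : ℂ} {w : Fin m → ℂ} :
    (Fin.snoc (α := fun _ => ℂ) w t : Fin (m + 1) → ℂ) ∈ ball (0 : Fin (m + 1) → ℂ) δ ↔
      w ∈ ball (0 : Fin m → ℂ) δ ∧ ‖t‖ < δ := by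
  simp [mem_ball_iff_forall hδ, Fin.forall_fin_succ']

theorem single_mem_ball_iff {m : ℕ} {δ : ℝ} (hδ : 0 < δ) {t : ℂ} {i : Fin m} :
    (Pi.single i t : Fin m → ℂ) ∈ ball (0 : Fin m → ℂ) δ ↔ ‖t‖ < δ := by
  rw [mem_ball_iff_forall hδ]
  refine ⟨fun h => by simpa using h i, fun h j => ?_⟩
  by_cases hj : j = i
  · subst hj
    simpa using h
  · simpa [hj] using hδ

theorem differentiable_cons {m : ℕ} :
    Differentiable ℂ fun q : ℂ × (Fin m → ℂ) => (Fin.cons q.1 q.2 : Fin (m + 1) → ℂ) := by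
  refine differentiable_pi.2 fun i => ?_
  refine Fin.cases ?_ (fun j => ?_) i
  · simp
  · simp only [Fin.cons_succ]
    fun_prop

theorem differentiable_snoc {m : ℕ} :
    Differentiable ℂ fun q : (Fin m → ℂ) × ℂ =>
      (Fin.snoc (α := fun _ => ℂ) q.1 q.2 : Fin (m + 1) → ℂ) := by
  refine differentiable_pi.2 fun i => ?_
  refine Fin.lastCases ?_ (fun j => ?_) i
  · simp
  · simp only [Fin.snoc_castSucc]
    fun_prop

/-- Restriction of a flag system to `z₁ = 0`. -/
def tailSystem {m : ℕ} (a : Fin (m + 1) → (Fin (m + 1) → ℂ) → ℂ) (i : Fin m) (w : Fin m → ℂ) : ℂ :=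
  a i.succ (Fin.cons 0 w)

/-- Restriction of the first `m` members of a flag system to `zₘ₊₁ = 0`. -/
def initSystem {m : ℕ} (a : Fin (m + 1) → (Fin (m + 1) → ℂ) → ℂ) (i : Fin m) (w : Fin m → ℂ) : ℂ :=
  a i.castSucc (Fin.snoc (α := fun _ => ℂ) w 0)

namespace IsFlagSystem

variable {m : ℕ} {δ : ℝ}

theorem tail {a : Fin (m + 1) → (Fin (m + 1) → ℂ) → ℂ} (hδ : 0 < δ) (ha : IsFlagSystem δ a) :
    IsFlagSystem δ (tailSystem a) where
  differentiableOn i := by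
    refine (ha.differentiableOn i.succ).comp (t := ball 0 δ) (f := fun w => Fin.cons 0 w) ?_ ?_
    · exact (differentiable_cons.comp
        ((differentiable_const (0 : ℂ)).prodMk differentiable_id)).differentiableOn
    · exact fun w hw => (cons_mem_ball_iff hδ).2 ⟨by simpa using hδ, hw⟩
  eq_of_eq i z hz w hw h := by
    refine ha.eq_of_eq i.succ _ ((cons_mem_ball_iff hδ).2 ⟨by simpa using hδ, hz⟩) _
      ((cons_mem_ball_iff hδ).2 ⟨by simpa using hδ, hw⟩) fun j => ?_
    refine Fin.cases (fun _ => rfl) (fun k hk => ?_) j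
    simpa using h k (Fin.succ_le_succ_iff.1 hk)
  ne_zero i t ht htδ := by
    have : (Fin.cons 0 (Pi.single i t) : Fin (m + 1) → ℂ) = Pi.single i.succ t := by
      ext j
      refine Fin.cases ?_ (fun k => ?_) j <;> simp [Pi.single_apply, Fin.ext_iff]
    rw [tailSystem, this]
    exact ha.ne_zero i.succ t ht htδ

theorem init {a : Fin (m + 1) → (Fin (m + 1) → ℂ) → ℂ} (hδ : 0 < δ) (ha : IsFlagSystem δ a) :
    IsFlagSystem δ (initSystem a) where
  differentiableOn i := by
    refine (ha.differentiableOn i.castSucc).comp (t := ball 0 δ)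
      (f := fun w => Fin.snoc (α := fun _ => ℂ) w 0) ?_ ?_
    · exact (differentiable_snoc.comp
        (differentiable_id.prodMk (differentiable_const (0 : ℂ)))).differentiableOn
    · exact fun w hw => (snoc_mem_ball_iff hδ).2 ⟨hw, by simpa using hδ⟩
  eq_of_eq i z hz w hw h := by
    refine ha.eq_of_eq i.castSucc _ ((snoc_mem_ball_iff hδ).2 ⟨hz, by simpa using hδ⟩) _
      ((snoc_mem_ball_iff hδ).2 ⟨hw, by simpa using hδ⟩) fun j => ?_
    refine Fin.lastCases (fun _ => by simp) (fun k hk => ?_) j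
    simpa using h k (Fin.castSucc_le_castSucc_iff.1 hk)
  ne_zero i t ht htδ := by
    have : (Fin.snoc (α := fun _ => ℂ) (Pi.single i t) 0 : Fin (m + 1) → ℂ) =
        Pi.single i.castSucc t := by
      ext j
      refine Fin.lastCases ?_ (fun k => ?_) j
      · simp [Fin.ext_iff, i.isLt.ne']
      · simp [Pi.single_apply, Fin.ext_iff]
    rw [initSystem, this]
    exact ha.ne_zero i.castSucc t ht htδ

theorem mono {a : Fin m → (Fin m → ℂ) → ℂ} {δ' : ℝ} (ha : IsFlagSystem δ a) (h : δ' ≤ δ) :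
    IsFlagSystem δ' a where
  differentiableOn i := (ha.differentiableOn i).mono (ball_subset_ball h)
  eq_of_eq i z hz w hw := ha.eq_of_eq i z (ball_subset_ball h hz) w (ball_subset_ball h hw)
  ne_zero i t ht htδ := ha.ne_zero i t ht (htδ.trans_le h)

/-- The first function depends on `z₁` alone, so its value can be read off on the first axis. -/
theorem zero_ne_zero {a : Fin (m + 1) → (Fin (m + 1) → ℂ) → ℂ} (hδ : 0 < δ)
    (ha : IsFlagSystem δ a) {z : Fin (m + 1) → ℂ} (hz : z ∈ ball (0 : Fin (m + 1) → ℂ) δ)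
    (hz0 : z 0 ≠ 0) : a 0 z ≠ 0 := by
  have h0 := (mem_ball_iff_forall hδ).1 hz 0
  rw [ha.eq_of_eq 0 z hz (Pi.single 0 (z 0)) ((single_mem_ball_iff hδ).2 h0)]
  · exact ha.ne_zero 0 _ hz0 h0
  · intro j hj
    obtain rfl : j = 0 := Fin.le_zero_iff.1 hj
    simp

theorem isOpen_inter {a : Fin m → (Fin m → ℂ) → ℂ} (ha : IsFlagSystem δ a) (i : Fin m) :
    IsOpen {z | z ∈ ball (0 : Fin m → ℂ) δ ∧ a i z ≠ 0} :=
  (ha.differentiableOn i).continuousOn.isOpen_inter_preimage isOpen_ball isOpen_ne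

/-- The radii for `z₂, …, zₙ` come from the slice `z₁ = 0`. Nonvanishing on the compact sets `|wᵢ| =
Rᵢ` of that slice persists for all small `|z₁|` by the tube lemma, so it remains to take `R₁` small.
-/
theorem exists_isFlagRadii {a : Fin m → (Fin m → ℂ) → ℂ} (hδ : 0 < δ) (ha : IsFlagSystem δ a) :
    ∃ R, IsFlagRadii a R ∧ ∀ i, R i < δ := by
  induction m with
  | zero => exact ⟨fun i => i.elim0, ⟨fun i => i.elim0, fun _ _ i => i.elim0⟩, fun i => i.elim0⟩
  | succ m ih =>
    obtain ⟨R, hR, hRδ⟩ := ih (ha.tail hδ)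
    have hK : ∀ i : Fin m, ∀ᶠ r : ℝ in 𝓝[>] 0, ∀ t : ℂ, ‖t‖ ≤ r → ∀ w : Fin m → ℂ,
        (∀ j, ‖w j‖ ≤ R j) → ‖w i‖ = R i → a i.succ (Fin.cons t w) ≠ 0 := by
      intro i
      set K : Set (Fin m → ℂ) := (univ.pi fun j => closedBall 0 (R j)) ∩ {w | ‖w i‖ = R i}
      have hKc : IsCompact K := (isCompact_univ_pi fun j => isCompact_closedBall 0 (R j)).inter_right
        (isClosed_eq (by fun_prop) continuous_const)
      have hopen : IsOpen ((fun q : ℂ × (Fin m → ℂ) => (Fin.cons q.1 q.2 : Fin (m + 1) → ℂ)) ⁻¹'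
          {z | z ∈ ball (0 : Fin (m + 1) → ℂ) δ ∧ a i.succ z ≠ 0}) :=
        (ha.isOpen_inter i.succ).preimage differentiable_cons.continuous
      obtain ⟨u, v, hu, -, hu', hv', huv⟩ :=
        generalized_tube_lemma (isCompact_singleton (x := (0 : ℂ))) hKc hopen (by
          rintro ⟨t, w⟩ ⟨ht, hw⟩
          obtain rfl : t = 0 := ht
          have hw1 : ∀ j, ‖w j‖ ≤ R j := fun j => by simpa using hw.1 j (mem_univ j)
          exact ⟨(cons_mem_ball_iff hδ).2 ⟨by simpa using hδ,
            (mem_ball_iff_forall hδ).2 fun j => (hw1 j).trans_lt (hRδ j)⟩, hR.ne_zero w hw1 i hw.2⟩)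
      obtain ⟨ε, hε, hεu⟩ := Metric.isOpen_iff.1 hu 0 (hu' rfl)
      filter_upwards [Ioo_mem_nhdsGT hε] with r hr t ht w hw hwi
      exact (huv ⟨hεu (by simpa using ht.trans_lt hr.2),
        hv' ⟨fun j _ => by simpa using hw j, hwi⟩⟩ : (t, w) ∈ _).2
    obtain ⟨r, hr, hr0⟩ := ((eventually_all.2 hK).and (Ioo_mem_nhdsGT hδ)).exists
    refine ⟨Fin.cons r R, ⟨?_, ?_⟩, ?_⟩
    · exact fun i => Fin.cases hr0.1 hR.pos i
    · intro z hz i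
      have hz0 : ‖z 0‖ ≤ r := hz 0
      have hzs : ∀ j : Fin m, ‖z j.succ‖ ≤ R j := fun j => hz j.succ
      refine Fin.cases (fun h => ?_) (fun j h => ?_) i
      · refine ha.zero_ne_zero hδ ((mem_ball_iff_forall hδ).2 fun k => ?_) ?_
        · exact (hz k).trans_lt (Fin.cases hr0.2 hRδ k)
        · rw [← norm_pos_iff, h]
          exact hr0.1
      · have := hr j (z 0) hz0 (Fin.tail z) hzs h
        rwa [Fin.cons_self_tail] at this
    · exact fun i => Fin.cases hr0.2 hRδ i

end IsFlagSystem

theorem NearFlag.mono {m : ℕ} {P Q : (Fin m → ℂ) → Prop} (hP : NearFlag m P)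
    (h : ∀ w, P w → Q w) : NearFlag m Q := by
  induction m with
  | zero => exact h _ hP
  | succ m ih => exact Eventually.mono hP fun t ht => ih ht fun w => h _

/-- The induction removes the last variable, as `NearFlag` does: a small nonzero `t` on the last
axis is not a zero of the last function, nor are nearby points, while the other functions do not see
the last coordinate. -/
theorem IsFlagSystem.nearFlag {m : ℕ} {δ : ℝ} {a : Fin m → (Fin m → ℂ) → ℂ} (hδ : 0 < δ)
    (ha : IsFlagSystem δ a) :
    NearFlag m fun w => w ∈ ball (0 : Fin m → ℂ) δ ∧ ∀ i, a i w ≠ 0 := by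
  induction m generalizing δ with
  | zero => exact ⟨by simpa [mem_ball_zero_iff, Subsingleton.elim (Fin.elim0 : Fin 0 → ℂ) 0] using hδ,
      fun i => i.elim0⟩
  | succ m ih =>
    filter_upwards [self_mem_nhdsWithin, mem_nhdsWithin_of_mem_nhds (ball_mem_nhds (0 : ℂ) hδ)]
      with t ht0 htδ
    rw [mem_ball_zero_iff] at htδ
    have hlast : (Fin.snoc (α := fun _ => ℂ) 0 t : Fin (m + 1) → ℂ) = Pi.single (Fin.last m) t := by
      ext j
      refine Fin.lastCases ?_ (fun k => ?_) j
      · simp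
      · simp [Fin.ext_iff, k.isLt.ne]
    have hnhds : ∀ᶠ w in 𝓝 (0 : Fin m → ℂ), a (Fin.last m) (Fin.snoc (α := fun _ => ℂ) w t) ≠ 0 := by
      have hc : Continuous fun w : Fin m → ℂ => (Fin.snoc (α := fun _ => ℂ) w t : Fin (m + 1) → ℂ) :=
        differentiable_snoc.continuous.comp (continuous_id.prodMk continuous_const)
      refine (hc.continuousAt.eventually ((ha.isOpen_inter (Fin.last m)).mem_nhds ?_)).mono
        fun w hw => hw.2
      change Fin.snoc (α := fun _ => ℂ) 0 t ∈ _
      rw [hlast]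
      exact ⟨(single_mem_ball_iff hδ).2 htδ, ha.ne_zero _ t ht0 htδ⟩
    obtain ⟨ε, hε, hεw⟩ := Metric.eventually_nhds_iff_ball.1 hnhds
    refine (ih (lt_min hε hδ) ((ha.init hδ).mono (min_le_right ε δ))).mono fun w hw => ?_
    have hwδ : w ∈ ball (0 : Fin m → ℂ) δ := ball_subset_ball (min_le_right _ _) hw.1
    have hmem := (snoc_mem_ball_iff hδ).2 ⟨hwδ, htδ⟩
    refine ⟨hmem, fun i => ?_⟩
    refine Fin.lastCases ?_ (fun k => ?_) i
    · exact hεw w (ball_subset_ball (min_le_left _ _) hw.1)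
    · have := hw.2 k
      rwa [initSystem, ha.eq_of_eq k.castSucc _
        ((snoc_mem_ball_iff hδ).2 ⟨hwδ, by simpa using hδ⟩) _ hmem] at this
      intro j hj
      obtain ⟨l, rfl⟩ : ∃ l : Fin m, j = l.castSucc :=
        ⟨⟨j, (Fin.le_def.1 hj).trans_lt k.isLt⟩, rfl⟩
      simp

/-! ### Iterated residues along a flag -/

theorem residue_eq_circleIntegral {f : ℂ → ℂ} {r : ℝ} (hr : 0 < r)
    (hf : ∀ t, t ≠ 0 → ‖t‖ ≤ r → DifferentiableAt ℂ f t) :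
    residue f 0 = (2 * Real.pi * Complex.I : ℂ)⁻¹ * ∮ t in C(0, r), f t := by
  refine Tendsto.limUnder_eq (tendsto_const_nhds.congr' ?_)
  filter_upwards [Ioc_mem_nhdsGT hr] with s hs
  congr 1
  refine Complex.circleIntegral_eq_of_differentiable_on_annulus_off_countable hs.1 hs.2
    countable_empty (fun t ht => ?_) (fun t ht => ?_)
  · refine (hf t ?_ (by simpa using ht.1)).continuousAt.continuousWithinAt
    rintro rfl
    exact ht.2 (mem_ball_self hs.1)
  · refine hf t ?_ (mem_ball_zero_iff.1 ht.1.1).le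
    rintro rfl
    exact ht.1.2 (mem_closedBall_self hs.1.le)

/-- The part of the polydisc of radius `δ` where no `aᵢ` vanishes. -/
def regularSet {m : ℕ} (δ : ℝ) (a : Fin m → (Fin m → ℂ) → ℂ) : Set (Fin m → ℂ) :=
  {z | z ∈ ball (0 : Fin m → ℂ) δ ∧ ∀ i, a i z ≠ 0}

theorem IsFlagSystem.isOpen_regularSet {m : ℕ} {δ : ℝ} {a : Fin m → (Fin m → ℂ) → ℂ}
    (ha : IsFlagSystem δ a) : IsOpen (regularSet δ a) := by
  have : regularSet δ a = ball 0 δ ∩ ⋂ i, {z | z ∈ ball (0 : Fin m → ℂ) δ ∧ a i z ≠ 0} := by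
    ext z
    simp only [regularSet, mem_ofPred_eq, mem_inter_iff, mem_iInter]
    exact ⟨fun h => ⟨h.1, fun i => ⟨h.1, h.2 i⟩⟩, fun h => ⟨h.1, fun i => (h.2 i).2⟩⟩
  rw [this]
  exact isOpen_ball.inter (isOpen_iInter_of_finite ha.isOpen_inter)

section FirstResidue

variable {m : ℕ} {δ : ℝ} {a : Fin (m + 1) → (Fin (m + 1) → ℂ) → ℂ} {F : (Fin (m + 1) → ℂ) → ℂ}

theorem IsFlagSystem.differentiableAt_cons (hδ : 0 < δ) (ha : IsFlagSystem δ a)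
    (hF : DifferentiableOn ℂ F (regularSet δ a)) {t : ℂ} {w : Fin m → ℂ} (ht : t ≠ 0)
    (htw : (Fin.cons t w : Fin (m + 1) → ℂ) ∈ ball (0 : Fin (m + 1) → ℂ) δ)
    (hne : ∀ i : Fin m, a i.succ (Fin.cons t w) ≠ 0) :
    DifferentiableAt ℂ (fun q : ℂ × (Fin m → ℂ) => F (Fin.cons q.1 q.2)) (t, w) := by
  have hmem : (Fin.cons t w : Fin (m + 1) → ℂ) ∈ regularSet δ a :=
    ⟨htw, fun i => Fin.cases (ha.zero_ne_zero hδ htw (by simpa using ht)) hne i⟩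
  exact (hF.differentiableAt (ha.isOpen_regularSet.mem_nhds hmem)).comp (t, w)
    differentiable_cons.differentiableAt

theorem IsFlagSystem.differentiableAt_slice (hδ : 0 < δ) (ha : IsFlagSystem δ a)
    (hF : DifferentiableOn ℂ F (regularSet δ a)) {t : ℂ} {w : Fin m → ℂ} (ht : t ≠ 0)
    (htw : (Fin.cons t w : Fin (m + 1) → ℂ) ∈ ball (0 : Fin (m + 1) → ℂ) δ)
    (hne : ∀ i : Fin m, a i.succ (Fin.cons t w) ≠ 0) :
    DifferentiableAt ℂ (fun t => F (Fin.cons t w)) t :=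
  DifferentiableAt.comp (g := fun q : ℂ × (Fin m → ℂ) => F (Fin.cons q.1 q.2))
    (f := fun t => (t, w)) t (ha.differentiableAt_cons hδ hF ht htw hne)
    (differentiableAt_id.prodMk (differentiableAt_const w))

/-- A radius valid for all parameters near `w` is what lets the first residue be written locally as
an integral over a fixed circle. -/
theorem IsFlagSystem.exists_radius (hδ : 0 < δ) (ha : IsFlagSystem δ a) {w : Fin m → ℂ}
    (hw : w ∈ regularSet δ (tailSystem a)) : ∃ r > 0, ∀ᶠ w' in 𝓝 w, ∀ t : ℂ, ‖t‖ ≤ r →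
      (Fin.cons t w' : Fin (m + 1) → ℂ) ∈ ball (0 : Fin (m + 1) → ℂ) δ ∧
        ∀ i : Fin m, a i.succ (Fin.cons t w') ≠ 0 := by
  have hev : ∀ᶠ q : ℂ × (Fin m → ℂ) in 𝓝 (0, w),
      (Fin.cons q.1 q.2 : Fin (m + 1) → ℂ) ∈ ball (0 : Fin (m + 1) → ℂ) δ ∧
        ∀ i : Fin m, a i.succ (Fin.cons q.1 q.2) ≠ 0 := by
    have hmem : (Fin.cons 0 w : Fin (m + 1) → ℂ) ∈ ball (0 : Fin (m + 1) → ℂ) δ :=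
      (cons_mem_ball_iff hδ).2 ⟨by simpa using hδ, hw.1⟩
    have hc := (differentiable_cons (m := m)).continuous.continuousAt (x := (0, w))
    refine (hc.eventually (isOpen_ball.mem_nhds hmem)).and (eventually_all.2 fun i => ?_)
    exact (hc.eventually ((ha.isOpen_inter i.succ).mem_nhds ⟨hmem, hw.2 i⟩)).mono fun q hq => hq.2
  rw [nhds_prod_eq] at hev
  obtain ⟨P, hP, Q, hQ, hPQ⟩ := eventually_prod_iff.1 hev
  obtain ⟨ε, hε, hεP⟩ := Metric.eventually_nhds_iff_ball.1 hP
  refine ⟨ε / 2, by positivity, hQ.mono fun w' hw' t ht => hPQ (hεP t ?_) hw'⟩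
  rw [mem_ball_zero_iff]
  linarith

theorem IsFlagSystem.hasIsolatedSingularity (hδ : 0 < δ) (ha : IsFlagSystem δ a)
    (hF : DifferentiableOn ℂ F (regularSet δ a)) {w : Fin m → ℂ}
    (hw : w ∈ regularSet δ (tailSystem a)) :
    HasIsolatedSingularity (fun t => F (Fin.cons t w)) 0 := by
  obtain ⟨r, hr, hev⟩ := ha.exists_radius hδ hw
  have hw' := hev.self_of_nhds
  filter_upwards [self_mem_nhdsWithin, mem_nhdsWithin_of_mem_nhds (closedBall_mem_nhds (0 : ℂ) hr)]
    with t ht0 htr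
  obtain ⟨h1, h2⟩ := hw' t (by simpa using htr)
  exact ha.differentiableAt_slice hδ hF ht0 h1 h2

/-- This closes the induction on the number of variables: the first residue satisfies, for the tail
system, the hypothesis that `F` satisfies for `a`. -/
theorem IsFlagSystem.differentiableOn_residue (hδ : 0 < δ) (ha : IsFlagSystem δ a)
    (hF : DifferentiableOn ℂ F (regularSet δ a)) :
    DifferentiableOn ℂ (fun w => residue (fun t => F (Fin.cons t w)) 0)
      (regularSet δ (tailSystem a)) := by
  intro w hw
  obtain ⟨r, hr, hev⟩ := ha.exists_radius hδ hw
  refine DifferentiableAt.differentiableWithinAt ?_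
  have heq : (fun w => residue (fun t => F (Fin.cons t w)) 0) =ᶠ[𝓝 w]
      fun w => (2 * Real.pi * Complex.I : ℂ)⁻¹ * ∮ t in C(0, r), F (Fin.cons t w) :=
    hev.mono fun w' hw' => residue_eq_circleIntegral hr fun t ht0 htr =>
      ha.differentiableAt_slice hδ hF ht0 (hw' t htr).1 (hw' t htr).2
  refine DifferentiableAt.congr_of_eventuallyEq (DifferentiableAt.const_mul ?_ _) heq
  refine differentiableAt_circleIntegral_of_eventually hr.le fun t ht => ?_
  rw [mem_sphere_zero_iff_norm] at ht
  have ht0 : t ≠ 0 := by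
    rw [← norm_pos_iff, ht]
    exact hr
  obtain ⟨h1, h2⟩ := hev.self_of_nhds t ht.le
  have hmem : (Fin.cons t w : Fin (m + 1) → ℂ) ∈ regularSet δ a :=
    ⟨h1, fun i => Fin.cases (ha.zero_ne_zero hδ h1 (by simpa using ht0)) h2 i⟩
  have hopen : IsOpen ((fun q : ℂ × (Fin m → ℂ) => (Fin.cons q.1 q.2 : Fin (m + 1) → ℂ)) ⁻¹'
      regularSet δ a) := ha.isOpen_regularSet.preimage differentiable_cons.continuous
  filter_upwards [hopen.mem_nhds (x := (t, w)) hmem] with q hq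
  exact DifferentiableAt.comp (g := F)
    (f := fun q : ℂ × (Fin m → ℂ) => (Fin.cons q.1 q.2 : Fin (m + 1) → ℂ)) q
    (hF.differentiableAt (ha.isOpen_regularSet.mem_nhds hq)) differentiable_cons.differentiableAt

end FirstResidue

theorem IsFlagRadii.tail {m : ℕ} {a : Fin (m + 1) → (Fin (m + 1) → ℂ) → ℂ} {R : Fin (m + 1) → ℝ}
    (hR : IsFlagRadii a R) : IsFlagRadii (tailSystem a) (Fin.tail R) where
  pos i := hR.pos i.succ
  ne_zero z hz i hi := hR.ne_zero _
    (fun j => Fin.cases (by simpa using (hR.pos 0).le) (fun k => hz k) j) i.succ hi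

theorem IsFlagRadii.torus_subset {m : ℕ} {δ : ℝ} {a : Fin m → (Fin m → ℂ) → ℂ} {R : Fin m → ℝ}
    (hδ : 0 < δ) (hR : IsFlagRadii a R) (hRδ : ∀ i, R i < δ) : torus R ⊆ regularSet δ a :=
  fun z hz => ⟨(mem_ball_iff_forall hδ).2 fun i => (hz i).trans_lt (hRδ i),
    fun i => hR.ne_zero z (fun j => (hz j).le) i (hz i)⟩

theorem IsFlagSystem.iteratedResidueExists {m : ℕ} {δ : ℝ} {a : Fin m → (Fin m → ℂ) → ℂ}
    (hδ : 0 < δ) (ha : IsFlagSystem δ a) {F : (Fin m → ℂ) → ℂ}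
    (hF : DifferentiableOn ℂ F (regularSet δ a)) : IteratedResidueExists m F := by
  induction m with
  | zero => trivial
  | succ m ih =>
    exact ⟨((ha.tail hδ).nearFlag hδ).mono fun w hw => ha.hasIsolatedSingularity hδ hF hw,
      ih (ha.tail hδ) (ha.differentiableOn_residue hδ hF)⟩

/-- The iterated residue is a torus integral. -/
theorem IsFlagSystem.iteratedResidue_eq {m : ℕ} {δ : ℝ} {a : Fin m → (Fin m → ℂ) → ℂ}
    (hδ : 0 < δ) (ha : IsFlagSystem δ a) {F : (Fin m → ℂ) → ℂ}
    (hF : DifferentiableOn ℂ F (regularSet δ a)) {R : Fin m → ℝ} (hR : IsFlagRadii a R)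
    (hRδ : ∀ i, R i < δ) :
    iteratedResidue m F = (2 * Real.pi * Complex.I : ℂ)⁻¹ ^ m * torusIntegral F 0 R := by
  induction m with
  | zero =>
    rw [torusIntegral_dim0]
    simp [iteratedResidue, Subsingleton.elim (Fin.elim0 : Fin 0 → ℂ) 0]
  | succ m ih =>
    rw [iteratedResidue, ih (ha.tail hδ) (ha.differentiableOn_residue hδ hF) hR.tail
      (fun i => hRδ i.succ), torusIntegral_eq_torusIntegral_circleIntegral (fun i => (hR.pos i).le)
        (hF.continuousOn.mono (hR.torus_subset hδ hRδ)) 0, pow_succ, mul_assoc (_ ^ m)]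
    congr 1
    rw [← torusIntegral_const_mul]
    refine torusIntegral_congr (fun i => (hR.pos i.succ).le) fun w hw => ?_
    simp only [Fin.insertNth_zero']
    have hwR : ∀ j : Fin m, ‖w j‖ = R j.succ := hw
    -- The circle of radius `R 0` need not be small a priori. By `IsFlagRadii` the later functions
    -- have no zeros over the whole disc `‖t‖ ≤ R 0`, so it can be contracted to `0`.
    refine residue_eq_circleIntegral (hR.pos 0) fun t ht0 htr => ?_
    have hle : ∀ j, ‖(Fin.cons t w : Fin (m + 1) → ℂ) j‖ ≤ R j := fun j =>
      Fin.cases (by simpa using htr) (fun k => by simpa using (hwR k).le) j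
    exact ha.differentiableAt_slice hδ hF ht0
      ((mem_ball_iff_forall hδ).2 fun j => (hle j).trans_lt (hRδ j))
      fun i => hR.ne_zero _ hle i.succ (by simpa using hwR i)

/-! ### The torus integral of a representing cocycle -/

theorem torusIntegral_sum {m : ℕ} {ι : Type*} (s : Finset ι) {R : Fin m → ℝ}
    {f : ι → (Fin m → ℂ) → ℂ} (hf : ∀ i ∈ s, TorusIntegrable (f i) 0 R) :
    torusIntegral (fun z => ∑ i ∈ s, f i z) 0 R = ∑ i ∈ s, torusIntegral (f i) 0 R := by
  simp only [torusIntegral, Finset.smul_sum]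
  exact integral_finsetSum s fun i hi => (hf i hi).function_integrable

/-- Cauchy's theorem in the `k`-th variable, integrated first. -/
theorem torusIntegral_eq_zero_of_differentiableAt {m : ℕ} {R : Fin (m + 1) → ℝ} (hR : ∀ i, 0 ≤ R i)
    {f : (Fin (m + 1) → ℂ) → ℂ} (k : Fin (m + 1))
    (hf : ∀ z, (∀ j, ‖z (k.succAbove j)‖ = R (k.succAbove j)) → ‖z k‖ ≤ R k →
      DifferentiableAt ℂ f z) : torusIntegral f 0 R = 0 := by
  rw [torusIntegral_eq_torusIntegral_circleIntegral hR
    (fun z hz => (hf z (fun j => hz _) (hz k).le).continuousAt.continuousWithinAt) k,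
    torusIntegral_congr (R := R ∘ k.succAbove) (g := fun _ => 0) (fun j => hR (k.succAbove j))
      fun y hy => ?_]
  · simp [torusIntegral]
  · have hd : ∀ x, ‖x‖ ≤ R k → DifferentiableAt ℂ (fun x => f (k.insertNth x y)) x := by
      intro x hx
      have hins : Differentiable ℂ fun x : ℂ => (k.insertNth x y : Fin (m + 1) → ℂ) :=
        differentiable_pi.2 fun i => by
          refine Fin.succAboveCases k ?_ (fun j => ?_) i <;> simp
      exact DifferentiableAt.comp (g := f) (f := fun x : ℂ => (k.insertNth x y : Fin (m + 1) → ℂ)) x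
        (hf _ (fun j => by simpa using hy j) (by simpa using hx)) hins.differentiableAt
    exact Complex.circleIntegral_eq_zero_of_differentiable_on_off_countable (hR k) countable_empty
      (fun x hx => (hd x (by simpa using hx)).continuousAt.continuousWithinAt)
      fun x hx => hd x (mem_ball_zero_iff.1 hx.1).le

theorem formCochain_id {m : ℕ} (h : (Fin m → ℂ) → ℂ) (a : Fin m → (Fin m → ℂ) → ℂ) :
    formCochain h a id = coeff h a := by
  ext z
  have : (Matrix.of fun k l : Fin m => if id k = l then (1 : ℂ) else 0) = 1 := by
    ext k l
    simp [Matrix.one_apply]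
  rw [formCochain, this, Matrix.det_one, one_mul]

theorem differentiableOn_coeff {m : ℕ} {δ : ℝ} {h : (Fin m → ℂ) → ℂ}
    {a : Fin m → (Fin m → ℂ) → ℂ} (hh : DifferentiableOn ℂ h (ball 0 δ))
    (ha : ∀ i, DifferentiableOn ℂ (a i) (ball 0 δ)) :
    DifferentiableOn ℂ (coeff h a) (regularSet δ a) := by
  have hsub : regularSet δ a ⊆ ball 0 δ := fun z hz => hz.1
  have hprod : DifferentiableOn ℂ (fun z => ∏ i, a i z) (regularSet δ a) :=
    fun z hz => (HasFDerivWithinAt.finsetProd fun i _ =>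
      ((ha i).mono hsub z hz).hasFDerivWithinAt).differentiableWithinAt
  have hne : ∀ z ∈ regularSet δ a, ∏ i, a i z ≠ 0 :=
    fun z hz => Finset.prod_ne_zero_iff.2 fun i _ => hz.2 i
  exact ((hh.mono hsub).mul (hprod.inv hne)).congr fun z _ => div_eq_mul_inv _ _

/-- A cocycle for the cover `{zᵢ ≠ 0}` in the class of the residue form has the same torus
integral as the form itself. -/
theorem torusIntegral_eq_of_cechCohomologous {p : ℕ} {δ : ℝ} (hδ : 0 < δ)
    {h : (Fin (p + 1) → ℂ) → ℂ} {a : Fin (p + 1) → (Fin (p + 1) → ℂ) → ℂ}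
    (hh : DifferentiableOn ℂ h (ball 0 δ)) (ha : ∀ i, DifferentiableOn ℂ (a i) (ball 0 δ))
    {β : (Fin (p + 1) → Fin (p + 1)) → (Fin (p + 1) → ℂ) → ℂ}
    (hβ : CechCohomologous (ball 0 δ) (denCover a) (coordCover (p + 1)) (formCochain h a) β)
    {R : Fin (p + 1) → ℝ} (hR : IsFlagRadii a R) (hRδ : ∀ i, R i < δ) :
    torusIntegral (β id) 0 R = torusIntegral (coeff h a) 0 R := by
  obtain ⟨γ, hγ, hd⟩ := hβ
  have hR0 : ∀ i, 0 ≤ R i := fun i => (hR.pos i).le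
  have hsub := hR.torus_subset hδ hRδ
  -- The coboundary relation is used only on the diagonal tuple of the refined cover, where both
  -- cocycles are evaluated at `(1, …, n)`.
  set q : Fin (p + 1) → Fin (p + 1) × Fin (p + 1) := fun k => (k, k)
  set T : Fin (p + 1) → (Fin (p + 1) → ℂ) → ℂ :=
    fun k z => (-1 : ℂ) ^ (k : ℕ) * γ (fun j => q (k.succAbove j)) z
  have hball : ∀ z : Fin (p + 1) → ℂ, (∀ j, ‖z j‖ ≤ R j) → z ∈ ball (0 : Fin (p + 1) → ℂ) δ :=
    fun z hz => (mem_ball_iff_forall hδ).2 fun i => (hz i).trans_lt (hRδ i)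
  have hne : ∀ z : Fin (p + 1) → ℂ, ∀ i, ‖z i‖ = R i → z i ≠ 0 := fun z i hi => by
    rw [← norm_pos_iff, hi]
    exact hR.pos i
  -- The `k`-th face involves only the sets with index `j ≠ k`, so `zₖ` may fill its disc; the flag
  -- radii keep `aⱼ` nonzero there.
  have hTd : ∀ k z, (∀ j, ‖z (k.succAbove j)‖ = R (k.succAbove j)) → ‖z k‖ ≤ R k →
      DifferentiableAt ℂ (T k) z := by
    intro k z hz hzk
    refine DifferentiableAt.const_mul ?_ _
    have hle : ∀ j, ‖z j‖ ≤ R j := fun j => Fin.succAboveCases k hzk (fun i => (hz i).le) j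
    refine (hγ _).differentiableAt ?_
    have h1 : ∀ᶠ w in 𝓝 z, ∀ j, a (k.succAbove j) w ≠ 0 := eventually_all.2 fun j =>
      (((ha _).differentiableAt (isOpen_ball.mem_nhds (hball z hle))).continuousAt).eventually_ne
        (hR.ne_zero z hle _ (hz j))
    have h2 : ∀ᶠ w in 𝓝 z, ∀ j, w (k.succAbove j) ≠ 0 := eventually_all.2 fun j =>
      (continuous_apply _).continuousAt.eventually_ne (hne z _ (hz j))
    filter_upwards [h1, h2, isOpen_ball.mem_nhds (hball z hle)] with w hw1 hw2 hw3
    exact ⟨hw3, fun j => ⟨hw1 j, hw2 j⟩⟩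
  have hTi : ∀ k, TorusIntegrable (T k) 0 R := fun k => torusIntegrable_of_continuousOn hR0
    fun z hz => (hTd k z (fun j => hz _) (hz k).le).continuousAt.continuousWithinAt
  have hTsum : torusIntegral (fun z => ∑ k, T k z) 0 R = 0 := by
    rw [torusIntegral_sum _ fun k _ => hTi k]
    exact Finset.sum_eq_zero fun k _ => torusIntegral_eq_zero_of_differentiableAt hR0 k (hTd k)
  have hci : TorusIntegrable (coeff h a) 0 R := torusIntegrable_of_continuousOn hR0
    ((differentiableOn_coeff hh ha).continuousOn.mono hsub)
  have hsi : TorusIntegrable (fun z => ∑ k, T k z) 0 R := torusIntegrable_of_continuousOn hR0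
    fun z hz => ContinuousAt.continuousWithinAt (tendsto_finsetSum _ fun k _ =>
      (hTd k z (fun j => hz _) (hz k).le).continuousAt)
  have key : EqOn (β id) (fun z => coeff h a z - ∑ k, T k z) (torus R) := by
    intro z hz
    have := hd q z ⟨hball z fun j => (hz j).le, fun k => ⟨(hsub hz).2 k, hne z k (hz k)⟩⟩
    change formCochain h a id z - β id z = ∑ k, T k z at this
    rw [formCochain_id] at this
    simp only [← this]
    ring
  rw [torusIntegral_congr hR0 key, torusIntegral_sub hci hsi, hTsum, sub_zero]

/-! ### Restrictions of the denominators to the coordinate axes -/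

/-- A Hurwitz-type persistence of zeros: the zero of `f` at the origin of the `k`-th axis survives,
nearby, on all parallel lines close to the axis. -/
theorem eventually_exists_update_eq_zero {n : ℕ} {f : (Fin n → ℂ) → ℂ} (k : Fin n)
    (hf : ∀ᶠ z in 𝓝 0, DifferentiableAt ℂ f z) (hf0 : f 0 = 0)
    (hne : ∀ᶠ t in 𝓝[≠] (0 : ℂ), f (Pi.single k t) ≠ 0) {ε : ℝ} (hε : 0 < ε) :
    ∀ᶠ z in 𝓝 (0 : Fin n → ℂ), ∃ t, ‖t‖ < ε ∧ f (Function.update z k t) = 0 := by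
  obtain ⟨ρ₁, hρ₁, hd⟩ := Metric.eventually_nhds_iff_ball.1 hf
  obtain ⟨ρ₂, hρ₂, hn⟩ := Metric.eventually_nhds_iff_ball.1 (eventually_nhdsWithin_iff.1 hne)
  set r := min ε (min ρ₁ ρ₂) / 2 with hr
  have hm : 0 < min ε (min ρ₁ ρ₂) := lt_min hε (lt_min hρ₁ hρ₂)
  have hr0 : 0 < r := by positivity
  have hrm : r < min ε (min ρ₁ ρ₂) := by linarith
  have hrε : r < ε := hrm.trans_le (min_le_left _ _)
  have hr1 : r < ρ₁ := hrm.trans_le ((min_le_right _ _).trans (min_le_left _ _))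
  have hr2 : r < ρ₂ := hrm.trans_le ((min_le_right _ _).trans (min_le_right _ _))
  have hupd : ∀ z ∈ ball (0 : Fin n → ℂ) ρ₁, ∀ t : ℂ, ‖t‖ ≤ r →
      Function.update z k t ∈ ball (0 : Fin n → ℂ) ρ₁ := by
    intro z hz t ht
    rw [mem_ball_iff_forall hρ₁] at hz ⊢
    intro j
    by_cases hj : j = k
    · subst hj
      simpa using ht.trans_lt hr1
    · simpa [hj] using hz j
  have hcont : ∀ z ∈ ball (0 : Fin n → ℂ) ρ₁, ∀ t : ℂ, ‖t‖ ≤ r →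
      ContinuousAt (fun q : (Fin n → ℂ) × ℂ => f (Function.update q.1 k q.2)) (z, t) := by
    intro z hz t ht
    exact ContinuousAt.comp (g := f) (f := fun q : (Fin n → ℂ) × ℂ => Function.update q.1 k q.2)
      (hd _ (hupd z hz t ht)).continuousAt (by fun_prop)
  have hball0 : (0 : Fin n → ℂ) ∈ ball (0 : Fin n → ℂ) ρ₁ := mem_ball_self hρ₁
  obtain ⟨t₀, ht₀, hmin⟩ := (isCompact_sphere (0 : ℂ) r).exists_isMinOn
    (NormedSpace.sphere_nonempty.2 hr0.le)
    (f := fun t => ‖f (Function.update 0 k t)‖) (by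
      intro t ht
      have := (hcont 0 hball0 t (by simpa using (mem_sphere_zero_iff_norm.1 ht).le)).comp
        (f := fun t => ((0 : Fin n → ℂ), t)) (by fun_prop)
      exact this.norm.continuousWithinAt)
  set m := ‖f (Function.update 0 k t₀)‖
  have hm0 : 0 < m := by
    rw [mem_sphere_zero_iff_norm] at ht₀
    refine norm_pos_iff.2 (hn t₀ (by simpa [ht₀] using hr2) ?_)
    rintro rfl
    simp at ht₀
    linarith
  have hsphere : ∀ᶠ z in 𝓝 (0 : Fin n → ℂ), ∀ t ∈ sphere (0 : ℂ) r,
      m / 2 < ‖f (Function.update z k t)‖ := by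
    refine (isCompact_sphere (0 : ℂ) r).eventually_forall_of_forall_eventually fun t ht => ?_
    have h1 : m / 2 < ‖f (Function.update 0 k t)‖ := by
      have : m ≤ ‖f (Function.update 0 k t)‖ := hmin ht
      linarith
    exact (hcont 0 hball0 t (mem_sphere_zero_iff_norm.1 ht).le).norm.eventually_const_lt h1
  have hcenter : ∀ᶠ z in 𝓝 (0 : Fin n → ℂ), ‖f (Function.update z k 0)‖ < m / 2 := by
    have := ((hcont 0 hball0 0 (by simpa using hr0.le)).comp
        (f := fun z : Fin n → ℂ => (z, (0 : ℂ))) (by fun_prop)).norm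
    refine this.eventually_lt_const ?_
    simpa [hf0] using hm0
  filter_upwards [hsphere, hcenter, ball_mem_nhds (0 : Fin n → ℂ) hρ₁] with z hz1 hz2 hz3
  by_contra! hcon
  have hz0 : ∀ t ∈ closedBall (0 : ℂ) r, f (Function.update z k t) ≠ 0 := fun t ht =>
    hcon t ((mem_closedBall_zero_iff.1 ht).trans_lt hrε)
  -- Without a zero, the reciprocal would be holomorphic on the disc and larger at the centre than
  -- on the boundary circle, against the maximum principle.
  have hdz : DifferentiableOn ℂ (fun t => (f (Function.update z k t))⁻¹) (closedBall 0 r) := by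
    intro t ht
    have hu : Differentiable ℂ fun t : ℂ => Function.update z k t :=
      differentiable_pi.2 fun j => by
        by_cases hj : j = k
        · subst hj
          simp
        · simp [hj]
    exact (DifferentiableAt.inv (DifferentiableAt.comp (g := f) t
      (hd _ (hupd z hz3 t (mem_closedBall_zero_iff.1 ht))) (hu t)) (hz0 t ht)).differentiableWithinAt
  have := Complex.norm_le_of_forall_mem_frontier_norm_le (C := (m / 2)⁻¹) (z := 0)
    (isBounded_ball (x := (0 : ℂ)) (r := r)) (hdz.mono closure_ball_subset_closedBall).diffContOnCl
    (fun t ht => by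
      rw [frontier_ball _ hr0.ne'] at ht
      rw [norm_inv]
      exact inv_anti₀ (by positivity) (hz1 t ht).le) (subset_closure (mem_ball_self hr0))
  rw [norm_inv, inv_le_inv₀ (norm_pos_iff.2 (hz0 0 (mem_closedBall_self hr0.le))) (by positivity)]
    at this
  linarith

theorem IsFlaglike.exists_radius {n : ℕ} {a : Fin n → (Fin n → ℂ) → ℂ} (ha : IsFlaglike a) :
    ∃ δ > 0, ∀ i, ∀ z ∈ ball (0 : Fin n → ℂ) δ, ∀ w ∈ ball (0 : Fin n → ℂ) δ,
      (∀ j ≤ i, z j = w j) → a i z = a i w := by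
  choose U hU h using ha
  obtain ⟨δ, hδ, hsub⟩ := Metric.mem_nhds_iff.1 (iInter_mem.2 hU)
  refine ⟨δ, hδ, fun i z hz w hw hzw => ?_⟩
  exact h i z (mem_iInter.1 (hsub hz) i) w (mem_iInter.1 (hsub hw) i) hzw

theorem analyticAt_single {n : ℕ} {f : (Fin n → ℂ) → ℂ} (hf : AnalyticAt ℂ f 0) (i : Fin n) :
    AnalyticAt ℂ (fun t : ℂ => f (Pi.single i t)) 0 := by
  have hs : AnalyticAt ℂ (fun t : ℂ => (Pi.single i t : Fin n → ℂ)) 0 :=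
    (ContinuousLinearMap.single ℂ (fun _ : Fin n => ℂ) i).analyticAt 0
  exact AnalyticAt.comp_of_eq hf hs (by simp)

/-- If `0` is an isolated common zero, then `aᵢ` does not vanish identically on
the `i`-th coordinate axis. -/
theorem eventually_single_ne_zero {n : ℕ} {a : Fin n → (Fin n → ℂ) → ℂ}
    (ha : ∀ i, AnalyticAt ℂ (a i) 0) (ha0 : ∀ i, a i 0 = 0)
    (hiso : ∀ᶠ z in 𝓝[≠] (0 : Fin n → ℂ), ∃ i, a i z ≠ 0) (hflag : IsFlaglike a) (i : Fin n) :
    ∀ᶠ t in 𝓝[≠] (0 : ℂ), a i (Pi.single i t) ≠ 0 := by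
  obtain ⟨δ, hδ, hf⟩ := hflag.exists_radius
  induction i using WellFoundedGT.induction with
  | ind i ih =>
  refine (analyticAt_single (ha i) i).eventually_eq_zero_or_eventually_ne_zero.resolve_left
    fun hzero => ?_
  -- If `aᵢ` vanished on its axis, common zeros of the first `k` functions with `z i ≠ 0` would
  -- exist arbitrarily close to `0`; `k = n` contradicts isolation. At the start, points of the
  -- `i`-th axis work, since the earlier functions see only zero coordinates.
  have key : ∀ k : ℕ, (i : ℕ) + 1 ≤ k → k ≤ n → ∀ ε > 0, ∃ z ∈ ball (0 : Fin n → ℂ) ε, z i ≠ 0 ∧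
      ∀ j : Fin n, (j : ℕ) < k → a j z = 0 := by
    intro k hk
    induction k, hk using Nat.le_induction with
    | base =>
      intro _ ε hε
      have hev : ∀ᶠ t in 𝓝[≠] (0 : ℂ), ‖t‖ < min ε δ ∧ a i (Pi.single i t) = 0 :=
        eventually_nhdsWithin_of_eventually_nhds
          (((continuous_norm.tendsto' (0 : ℂ) 0 norm_zero).eventually_lt_const
            (lt_min hε hδ)).and hzero)
      obtain ⟨t, ⟨ht, hat⟩, ht0⟩ := (hev.and self_mem_nhdsWithin).exists
      refine ⟨Pi.single i t, (single_mem_ball_iff hε).2 (ht.trans_le (min_le_left _ _)),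
        by simpa using ht0, fun j hj => ?_⟩
      rcases (Nat.lt_succ_iff.1 hj).lt_or_eq with hlt | heq
      · rw [hf j _ ((single_mem_ball_iff hδ).2 (ht.trans_le (min_le_right _ _))) 0
          (mem_ball_self hδ), ha0]
        intro l hl
        have : l ≠ i := (hl.trans_lt (Fin.lt_def.2 hlt)).ne
        simp [this]
      · rwa [Fin.ext heq]
    | succ k hk ihk =>
      intro hkn ε hε
      -- The next function can be made to vanish by moving only its own coordinate, which the
      -- earlier functions do not see; the descending induction on `i` provides its nonvanishing on
      -- the `l`-th axis.
      set l : Fin n := ⟨k, hkn⟩ with hl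
      have hil : i < l := Fin.lt_def.2 (by simpa [hl] using hk)
      obtain ⟨η, hη, hηz⟩ := Metric.eventually_nhds_iff_ball.1
        (eventually_exists_update_eq_zero l
          ((ha l).eventually_analyticAt.mono fun z hz => hz.differentiableAt) (ha0 l) (ih l hil)
          (lt_min hε hδ))
      have hm : 0 < min ε δ := lt_min hε hδ
      obtain ⟨z, hz, hzi, hza⟩ := ihk (Nat.le_of_succ_le hkn) _ (lt_min hη hm)
      obtain ⟨t, ht, hat⟩ := hηz z (ball_subset_ball (min_le_left _ _) hz)
      have hzm : z ∈ ball (0 : Fin n → ℂ) (min ε δ) := ball_subset_ball (min_le_right _ _) hz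
      have hum : Function.update z l t ∈ ball (0 : Fin n → ℂ) (min ε δ) := by
        rw [mem_ball_iff_forall hm] at hzm ⊢
        intro j
        by_cases hj : j = l
        · subst hj
          simpa using ht
        · simpa [hj] using hzm j
      refine ⟨_, ball_subset_ball (min_le_left _ _) hum, by simpa [hil.ne] using hzi, fun j hj => ?_⟩
      rcases (Nat.lt_succ_iff.1 hj).lt_or_eq with hlt | heq
      · rw [hf j _ (ball_subset_ball (min_le_right _ _) hum) z
          (ball_subset_ball (min_le_right _ _) hzm), hza j hlt]
        intro j' hj'
        have : j' ≠ l := (hj'.trans_lt (Fin.lt_def.2 hlt)).ne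
        simp [this]
      · have : j = l := Fin.ext heq
        rwa [this]
  obtain ⟨ε, hε, hεz⟩ := Metric.eventually_nhds_iff_ball.1 (eventually_nhdsWithin_iff.1 hiso)
  obtain ⟨z, hz, hzi, hza⟩ := key n i.isLt le_rfl ε hε
  obtain ⟨j, hj⟩ := hεz z hz fun h0 => hzi (by
    rw [mem_singleton_iff] at h0
    simp [h0])
  exact hj (hza j j.isLt)

/-! ### Powers of the coordinates in the ideal of the denominators -/

theorem update_mem_ball {n : ℕ} {ρ : ℝ} (hρ : 0 < ρ) {z : Fin n → ℂ}
    (hz : z ∈ ball (0 : Fin n → ℂ) ρ) (j : Fin n) {t : ℂ} (ht : ‖t‖ < ρ) :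
    Function.update z j t ∈ ball (0 : Fin n → ℂ) ρ := by
  rw [mem_ball_iff_forall hρ] at hz ⊢
  intro l
  by_cases hl : l = j
  · subst hl
    simpa using ht
  · simpa [hl] using hz l

theorem differentiable_update {n : ℕ} (j : Fin n) :
    Differentiable ℂ fun q : ℂ × (Fin n → ℂ) => Function.update q.2 j q.1 :=
  differentiable_pi.2 fun l => by
    by_cases hl : l = j
    · subst hl
      simp only [Function.update_self]
      fun_prop
    · simp only [Function.update_of_ne hl]
      fun_prop

/-- The ring of functions holomorphic near `0`. -/
def holomorphicNear (n : ℕ) : Subring ((Fin n → ℂ) → ℂ) where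
  carrier := {f | ∀ᶠ z in 𝓝 0, DifferentiableAt ℂ f z}
  mul_mem' hf hg := by
    filter_upwards [hf, hg] with z h1 h2 using h1.mul h2
  one_mem' := Eventually.of_forall fun z => differentiableAt_const _
  add_mem' hf hg := by
    filter_upwards [hf, hg] with z h1 h2 using h1.add h2
  zero_mem' := Eventually.of_forall fun z => differentiableAt_const _
  neg_mem' hf := by
    filter_upwards [hf] with z h1 using h1.neg

theorem mem_holomorphicNear {n : ℕ} {f : (Fin n → ℂ) → ℂ} :
    f ∈ holomorphicNear n ↔ ∀ᶠ z in 𝓝 0, DifferentiableAt ℂ f z := Iff.rfl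

/-- Division by a coordinate with holomorphic quotient: subtract Cauchy's formulas at `z j` and at
`0` and take `z j` out of the difference of kernels. -/
theorem exists_sub_update_eq_mul {n : ℕ} {f : (Fin n → ℂ) → ℂ} (hf : f ∈ holomorphicNear n)
    (j : Fin n) : ∃ g ∈ holomorphicNear n,
      ∀ᶠ z in 𝓝 (0 : Fin n → ℂ), f z - f (Function.update z j 0) = z j * g z := by
  obtain ⟨ρ, hρ, hd⟩ := Metric.eventually_nhds_iff_ball.1 (mem_holomorphicNear.1 hf)
  set r := ρ / 2 with hr
  have hr0 : 0 < r := by positivity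
  have hrρ : r < ρ := by linarith
  have hupd : ∀ z ∈ ball (0 : Fin n → ℂ) r, ∀ t : ℂ, ‖t‖ ≤ r →
      DifferentiableAt ℂ f (Function.update z j t) := fun z hz t ht =>
    hd _ (update_mem_ball hρ (ball_subset_ball hrρ.le hz) j (ht.trans_lt hrρ))
  have hsub : ∀ z ∈ ball (0 : Fin n → ℂ) r, ∀ t : ℂ, ‖t‖ = r → t - z j ≠ 0 := by
    intro z hz t ht h0
    have := (mem_ball_iff_forall hr0).1 hz j
    rw [← sub_eq_zero.1 h0, ht] at this
    exact lt_irrefl _ this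
  refine ⟨fun z => (2 * Real.pi * Complex.I : ℂ)⁻¹ *
    ∮ t in C(0, r), (t - z j)⁻¹ * (t⁻¹ * f (Function.update z j t)), ?_, ?_⟩
  · refine mem_holomorphicNear.2 ?_
    filter_upwards [ball_mem_nhds (0 : Fin n → ℂ) hr0] with z hz
    refine DifferentiableAt.const_mul ?_ _
    refine differentiableAt_circleIntegral_of_eventually hr0.le fun t ht => ?_
    rw [mem_sphere_zero_iff_norm] at ht
    have ht0 : t ≠ 0 := by
      rw [← norm_pos_iff, ht]
      exact hr0
    have h1 : ∀ᶠ q : ℂ × (Fin n → ℂ) in 𝓝 (t, z), q.1 ≠ 0 :=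
      continuousAt_fst.eventually_ne ht0
    have h2 : ∀ᶠ q : ℂ × (Fin n → ℂ) in 𝓝 (t, z), q.1 - q.2 j ≠ 0 :=
      ContinuousAt.eventually_ne (by fun_prop) (hsub z hz t ht)
    have h3 : ∀ᶠ q : ℂ × (Fin n → ℂ) in 𝓝 (t, z),
        Function.update q.2 j q.1 ∈ ball (0 : Fin n → ℂ) ρ :=
      (differentiable_update j).continuous.continuousAt.eventually (isOpen_ball.mem_nhds
        (update_mem_ball hρ (ball_subset_ball hrρ.le hz) j (ht.trans_lt hrρ)))
    filter_upwards [h1, h2, h3] with q hq1 hq2 hq3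
    have hfu : DifferentiableAt ℂ (fun q : ℂ × (Fin n → ℂ) => f (Function.update q.2 j q.1)) q :=
      DifferentiableAt.comp (g := f) q (hd _ hq3) (differentiable_update j q)
    have hs : DifferentiableAt ℂ (fun q : ℂ × (Fin n → ℂ) => q.1 - q.2 j) q := by fun_prop
    exact (hs.inv hq2).mul ((differentiableAt_fst.inv hq1).mul hfu)
  · filter_upwards [ball_mem_nhds (0 : Fin n → ℂ) hr0] with z hz
    have hφ : DifferentiableOn ℂ (fun t => f (Function.update z j t)) (closedBall 0 r) := by
      intro t ht
      have : DifferentiableAt ℂ (fun t : ℂ => Function.update z j t) t :=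
        DifferentiableAt.comp (g := fun q : ℂ × (Fin n → ℂ) => Function.update q.2 j q.1)
          (f := fun t => (t, z)) t (differentiable_update j (t, z))
          (differentiableAt_id.prodMk (differentiableAt_const z))
      exact (DifferentiableAt.comp (g := f) t (hupd z hz t (mem_closedBall_zero_iff.1 ht))
        this).differentiableWithinAt
    have hzj : z j ∈ ball (0 : ℂ) r := by
      simpa using (mem_ball_iff_forall hr0).1 hz j
    have hC1 := hφ.circleIntegral_sub_inv_smul hzj
    have hC0 := hφ.circleIntegral_sub_inv_smul (mem_ball_self hr0)
    have hc : ContinuousOn (fun t => f (Function.update z j t)) (sphere 0 r) :=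
      hφ.continuousOn.mono sphere_subset_closedBall
    have hi : ∀ w ∈ ball (0 : ℂ) r,
        CircleIntegrable (fun t => (t - w)⁻¹ • f (Function.update z j t)) 0 r := by
      intro w hw
      refine ContinuousOn.circleIntegrable hr0.le
        (ContinuousOn.fun_smul (f := fun t => (t - w)⁻¹) ?_ hc)
      refine ContinuousOn.inv₀ (by fun_prop) fun t ht h0 => ?_
      rw [sub_eq_zero.1 h0] at ht
      exact (mem_ball.1 hw).ne (mem_sphere.1 ht)
    have hpi : (2 * Real.pi * Complex.I : ℂ) ≠ 0 := Complex.two_pi_I_ne_zero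
    have hdiff : (2 * Real.pi * Complex.I : ℂ) * (f z - f (Function.update z j 0)) =
        z j * ∮ t in C(0, r), (t - z j)⁻¹ * (t⁻¹ * f (Function.update z j t)) := by
      rw [Function.update_eq_self] at hC1
      rw [smul_eq_mul] at hC0 hC1
      rw [mul_sub, ← hC0, ← hC1, ← circleIntegral.integral_sub (hi _ hzj) (hi _ (mem_ball_self hr0)),
        ← circleIntegral.integral_const_mul]
      refine circleIntegral.integral_congr hr0.le fun t ht => ?_
      have h1 := hsub z hz t (mem_sphere_zero_iff_norm.1 ht)
      have h2 : t ≠ 0 := by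
        rw [← norm_pos_iff, mem_sphere_zero_iff_norm.1 ht]
        exact hr0
      simp only [smul_eq_mul, sub_zero]
      field_simp
      ring
    rw [mul_left_comm, ← hdiff, inv_mul_cancel_left₀ hpi]

/-- The coordinates in `S` are replaced by `0`. -/
def zeroOut {n : ℕ} (S : Finset (Fin n)) (z : Fin n → ℂ) : Fin n → ℂ :=
  fun i => if i ∈ S then 0 else z i

theorem comp_zeroOut_mem {n : ℕ} (S : Finset (Fin n)) {f : (Fin n → ℂ) → ℂ}
    (hf : f ∈ holomorphicNear n) : f ∘ zeroOut S ∈ holomorphicNear n := by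
  have hd : Differentiable ℂ (zeroOut S) := differentiable_pi.2 fun i => by
    by_cases hi : i ∈ S
    · simp [zeroOut, hi]
    · simp only [zeroOut, hi, if_false]
      fun_prop
  have h0 : Tendsto (zeroOut S) (𝓝 0) (𝓝 0) :=
    hd.continuous.tendsto' 0 0 (by ext; simp [zeroOut])
  exact (h0.eventually (mem_holomorphicNear.1 hf)).mono fun z hz => hz.comp z (hd z)

/-- The `i`-th coordinate function. -/
def coordNear {n : ℕ} (i : Fin n) : holomorphicNear n :=
  ⟨fun z => z i, Eventually.of_forall fun z => by fun_prop⟩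

/-- Modulo an ideal containing the coordinates in `S`, these may be set to `0`, one at a time.
Elements of `holomorphicNear` are functions rather than germs, so `hJ` is what allows identities
near `0` to be used. -/
theorem sub_comp_zeroOut_mem {n : ℕ} {J : Ideal (holomorphicNear n)}
    (hJ : ∀ f : holomorphicNear n, f.1 =ᶠ[𝓝 0] 0 → f ∈ J) (S : Finset (Fin n))
    (hS : ∀ j ∈ S, coordNear j ∈ J) (f : holomorphicNear n) :
    f - ⟨f.1 ∘ zeroOut S, comp_zeroOut_mem S f.2⟩ ∈ J := by
  induction S using Finset.induction_on with
  | empty =>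
    refine hJ _ (Eventually.of_forall fun z => ?_)
    have : zeroOut ∅ z = z := by
      ext
      simp [zeroOut]
    simp [this]
  | insert j S hj ih =>
    have h1 := ih fun l hl => hS l (Finset.mem_insert_of_mem hl)
    obtain ⟨g, hg, hgz⟩ := exists_sub_update_eq_mul (comp_zeroOut_mem S f.2) j
    have h2 : coordNear j * ⟨g, hg⟩ ∈ J :=
      J.mul_mem_right _ (hS j (Finset.mem_insert_self j S))
    have h3 : (f - ⟨f.1 ∘ zeroOut (insert j S), comp_zeroOut_mem _ f.2⟩) -
        ((f - ⟨f.1 ∘ zeroOut S, comp_zeroOut_mem S f.2⟩) + coordNear j * ⟨g, hg⟩) ∈ J := by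
      refine hJ _ (hgz.mono fun z hz => ?_)
      have hz0 : zeroOut S (Function.update z j 0) = zeroOut (insert j S) z := by
        ext l
        by_cases hl : l = j
        · subst hl
          simp [zeroOut]
        · simp [zeroOut, hl]
      simp only [Function.comp_apply, hz0] at hz
      change (f.1 z - f.1 (zeroOut (insert j S) z)) -
        ((f.1 z - f.1 (zeroOut S z)) + z j * g z) = 0
      rw [← hz]
      ring
    exact (Submodule.sub_mem_iff_left J (J.add_mem h1 h2)).1 h3

/-- The functions which near `0` are combinations of the `aⱼ`. -/
def denIdeal {n : ℕ} (a : Fin n → (Fin n → ℂ) → ℂ) : Ideal (holomorphicNear n) where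
  carrier := {f | ∃ c : Fin n → holomorphicNear n, ∀ᶠ z in 𝓝 0, f.1 z = ∑ j, (c j).1 z * a j z}
  add_mem' := by
    rintro f g ⟨c, hc⟩ ⟨d, hd⟩
    refine ⟨c + d, ?_⟩
    filter_upwards [hc, hd] with z h1 h2
    simp [h1, h2, add_mul, Finset.sum_add_distrib]
  zero_mem' := ⟨0, Eventually.of_forall fun z => by simp⟩
  smul_mem' := by
    rintro g f ⟨c, hc⟩
    refine ⟨fun j => g * c j, hc.mono fun z hz => ?_⟩
    simp [hz, Finset.mul_sum, mul_assoc]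

theorem mem_denIdeal_of_eventuallyEq_zero {n : ℕ} {a : Fin n → (Fin n → ℂ) → ℂ}
    {f : holomorphicNear n} (hf : f.1 =ᶠ[𝓝 0] 0) : f ∈ denIdeal a :=
  ⟨0, hf.mono fun z hz => by simpa using hz⟩

/-- By induction the earlier coordinates lie in the radical, so modulo it `aᵢ` becomes its
restriction to the `i`-th axis, which is a power of `zᵢ` times a unit. -/
theorem coordNear_mem_radical {n : ℕ} {a : Fin n → (Fin n → ℂ) → ℂ}
    (ha : ∀ i, AnalyticAt ℂ (a i) 0) (hflag : IsFlaglike a)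
    (hne : ∀ i, ∀ᶠ t in 𝓝[≠] (0 : ℂ), a i (Pi.single i t) ≠ 0) (i : Fin n) :
    coordNear i ∈ (denIdeal a).radical := by
  obtain ⟨δ, hδ, hf⟩ := hflag.exists_radius
  induction i using WellFoundedLT.induction with
  | ind i ih =>
  set J := (denIdeal a).radical
  have hJ : ∀ f : holomorphicNear n, f.1 =ᶠ[𝓝 0] 0 → f ∈ J := fun f hf =>
    Ideal.le_radical (mem_denIdeal_of_eventuallyEq_zero hf)
  set A : holomorphicNear n :=
    ⟨a i, (ha i).eventually_analyticAt.mono fun z hz => hz.differentiableAt⟩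
  have hA : A ∈ J := by
    refine Ideal.le_radical ⟨Pi.single i 1, Eventually.of_forall fun z => ?_⟩
    rw [Finset.sum_eq_single i]
    · simp [A]
    · intro j _ hj
      simp [hj]
    · simp
  have hAz := (Submodule.sub_mem_iff_right J hA).1
    (sub_comp_zeroOut_mem hJ (Finset.Iio i) (fun j hj => ih j (Finset.mem_Iio.1 hj)) A)
  -- Factor the restriction as `t ^ k * g t` with `g 0 ≠ 0`; multiplying by `1 / g` will leave `zᵢ ^
  -- k` in the radical.
  obtain ⟨k, g, hg, hg0, hgz⟩ :=
    (analyticAt_single (ha i) i).exists_eventuallyEq_pow_smul_nonzero_iff.2 fun h0 =>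
      ((hne i).and (eventually_nhdsWithin_of_eventually_nhds h0)).exists.elim fun t ht => ht.1 ht.2
  have hproj : Tendsto (fun z : Fin n → ℂ => z i) (𝓝 0) (𝓝 0) :=
    (continuous_apply i).tendsto' 0 0 rfl
  have hG : (fun z : Fin n → ℂ => (g (z i))⁻¹) ∈ holomorphicNear n := by
    refine mem_holomorphicNear.2 ?_
    filter_upwards [hproj.eventually hg.eventually_analyticAt,
      hproj.eventually (hg.continuousAt.eventually_ne hg0)] with z h1 h2
    exact (DifferentiableAt.comp (g := g) z h1.differentiableAt (by fun_prop)).inv h2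
  have hmem := J.mul_mem_left ⟨_, hG⟩ hAz
  have hpow : coordNear i ^ k ∈ J := by
    refine (Submodule.sub_mem_iff_left J hmem).1 (hJ _ ?_)
    filter_upwards [hproj.eventually hgz, hproj.eventually (hg.continuousAt.eventually_ne hg0),
      ball_mem_nhds (0 : Fin n → ℂ) hδ] with z h1 h2 h3
    have h3' := (mem_ball_iff_forall hδ).1 h3
    have h4 : a i (zeroOut (Finset.Iio i) z) = a i (Pi.single i (z i)) := by
      refine hf i _ ((mem_ball_iff_forall hδ).2 fun j => ?_) _
        ((single_mem_ball_iff hδ).2 (h3' i)) fun j hj => ?_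
      · by_cases hj : j < i
        · simpa [zeroOut, hj] using hδ
        · simpa [zeroOut, hj] using h3' j
      · rcases hj.lt_or_eq with hlt | rfl
        · simp [zeroOut, hlt, hlt.ne]
        · simp [zeroOut]
    change z i ^ k - (g (z i))⁻¹ * a i (zeroOut (Finset.Iio i) z) = 0
    rw [h4, h1, sub_zero, smul_eq_mul]
    field_simp
    ring
  exact (Ideal.radical_isRadical (denIdeal a)) ⟨k, hpow⟩

/-- Near `0` some power of each coordinate is a combination of the denominators. -/
theorem exists_pow_eq_sum {n : ℕ} {a : Fin n → (Fin n → ℂ) → ℂ}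
    (ha : ∀ i, AnalyticAt ℂ (a i) 0) (hflag : IsFlaglike a)
    (hne : ∀ i, ∀ᶠ t in 𝓝[≠] (0 : ℂ), a i (Pi.single i t) ≠ 0) :
    ∃ (N : Fin n → ℕ) (c : Fin n → Fin n → (Fin n → ℂ) → ℂ),
      ∀ᶠ z in 𝓝 (0 : Fin n → ℂ), (∀ i l, DifferentiableAt ℂ (c i l) z) ∧
        ∀ i, z i ^ N i = ∑ l, c i l z * a l z := by
  choose N c hc using coordNear_mem_radical ha hflag hne
  refine ⟨N, fun i l => (c i l).1, ?_⟩
  have h1 : ∀ᶠ z in 𝓝 (0 : Fin n → ℂ), ∀ i l, DifferentiableAt ℂ (c i l).1 z :=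
    eventually_all.2 fun i => eventually_all.2 fun l => mem_holomorphicNear.1 (c i l).2
  exact h1.and (eventually_all.2 hc)

/-! ### The prism homotopy -/

section Prism

theorem val_succAbove {n : ℕ} (k : Fin (n + 1)) (i : Fin n) :
    (k.succAbove i : ℕ) = if (i : ℕ) < k then (i : ℕ) else i + 1 := by
  simp only [Fin.succAbove, Fin.lt_def, Fin.val_castSucc]
  split_ifs <;> rfl

theorem val_predAbove {n : ℕ} (i : Fin n) (k : Fin (n + 1)) :
    (i.predAbove k : ℕ) = if (i : ℕ) < k then (k : ℕ) - 1 else k := by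
  simp only [Fin.predAbove, Fin.lt_def, Fin.val_castSucc]
  split_ifs <;> rfl

variable {p : ℕ} {Q V : Type*}

/-- The sequence `u (q 0), …, u (q k), v (q k), …, v (q (p - 1))`. -/
def prism (u v : Q → V) (k : Fin p) (q : Fin p → Q) (i : Fin (p + 1)) : V :=
  if i ≤ k.castSucc then u (q (k.predAbove i)) else v (q (k.predAbove i))

/-- The sequence `u (s 0), …, u (s (t - 1)), v (s t), …, v (s p)`. -/
def splice (u v : Q → V) (s : Fin (p + 1) → Q) (t : Fin (p + 2)) (i : Fin (p + 1)) : V :=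
  if i.castSucc < t then u (s i) else v (s i)

theorem prism_succAbove_castSucc (u v : Q → V) (s : Fin (p + 1) → Q) (k : Fin (p + 1)) :
    (fun i => prism u v k s (k.castSucc.succAbove i)) = splice u v s k.castSucc := by
  ext i
  have h1 : k.predAbove (k.castSucc.succAbove i) = i := by
    ext
    simp only [val_predAbove, val_succAbove, Fin.val_castSucc]
    split_ifs <;> omega
  have h2 : k.castSucc.succAbove i ≤ k.castSucc ↔ i.castSucc < k.castSucc := by
    simp only [val_succAbove, Fin.val_castSucc, Fin.lt_def, Fin.le_def]
    split_ifs <;> omega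
  simp only [prism, splice, h1, h2]

theorem prism_succAbove_succ (u v : Q → V) (s : Fin (p + 1) → Q) (k : Fin (p + 1)) :
    (fun i => prism u v k s (k.succ.succAbove i)) = splice u v s k.succ := by
  ext i
  have h1 : k.predAbove (k.succ.succAbove i) = i := by
    ext
    simp only [val_predAbove, val_succAbove, Fin.val_succ]
    split_ifs <;> omega
  have h2 : k.succ.succAbove i ≤ k.castSucc ↔ i.castSucc < k.succ := by
    simp only [val_succAbove, Fin.val_castSucc, Fin.val_succ, Fin.lt_def, Fin.le_def]
    split_ifs <;> omega
  simp only [prism, splice, h1, h2]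

/-- The outer faces of a prism over `s` are prisms over faces of `s`; the two faces at the switch
from `u` to `v` are the splices treated above. -/
theorem prism_succAbove_succAbove (u v : Q → V) (s : Fin (p + 1) → Q) (k : Fin (p + 1))
    (i : Fin p) : (fun l => prism u v k s ((k.castSucc.succAbove (k.succAbove i)).succAbove l)) =
      prism u v (i.predAbove k) (fun l => s ((k.succAbove i).succAbove l)) := by
  ext l
  have h1 : k.predAbove ((k.castSucc.succAbove (k.succAbove i)).succAbove l) =
      (k.succAbove i).succAbove ((i.predAbove k).predAbove l) := by
    ext
    simp only [val_predAbove, val_succAbove, Fin.val_castSucc]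
    split_ifs <;> omega
  have h2 : (k.castSucc.succAbove (k.succAbove i)).succAbove l ≤ k.castSucc ↔
      l ≤ (i.predAbove k).castSucc := by
    simp only [val_predAbove, val_succAbove, Fin.val_castSucc, Fin.le_def]
    split_ifs <;> omega
  simp only [prism, h1, h2]

/-- The involution of the set of pairs which exchanges the order in which two
entries of a sequence are omitted. -/
def omitSwap (p : ℕ) : Fin (p + 1) × Fin p ≃ Fin (p + 1) × Fin p :=
  Function.Involutive.toPerm (fun x => (x.1.succAbove x.2, x.2.predAbove x.1)) (by
    rintro ⟨k, i⟩
    ext <;>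
    · simp only [val_predAbove, val_succAbove]
      split_ifs <;> omega)

theorem neg_one_pow_omitSwap (k : Fin (p + 1)) (i : Fin p) :
    (-1 : ℂ) ^ (k : ℕ) * (-1) ^ (k.castSucc.succAbove (k.succAbove i) : ℕ) =
      -((-1) ^ (k.succAbove i : ℕ) * (-1) ^ (i.predAbove k : ℕ)) := by
  rcases lt_or_ge (i : ℕ) k with h | h
  · obtain ⟨l, hl⟩ : ∃ l, (k : ℕ) = l + 1 := ⟨k - 1, by omega⟩
    rw [hl] at h
    simp only [val_succAbove, val_predAbove, Fin.val_castSucc, hl, h, if_true, pow_succ,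
      Nat.add_sub_cancel]
    ring
  · have h2 : ¬ (i : ℕ) + 1 < k := by omega
    simp only [val_succAbove, val_predAbove, Fin.val_castSucc, h.not_gt, h2, if_false]
    ring

/-- If the alternating sums of `D` vanish, then `D ∘ u` and `D ∘ v` are homotopic. -/
theorem sub_eq_sum_prism {D : (Fin (p + 1) → V) → ℂ} {u v : Q → V} (s : Fin (p + 1) → Q)
    (hD : ∀ k, ∑ i : Fin (p + 2), (-1 : ℂ) ^ (i : ℕ) *
      D (fun l => prism u v k s (i.succAbove l)) = 0) :
    D (fun i => v (s i)) - D (fun i => u (s i)) = ∑ j : Fin (p + 1), (-1 : ℂ) ^ (j : ℕ) *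
      ∑ k : Fin p, (-1 : ℂ) ^ (k : ℕ) * D (prism u v k fun l => s (j.succAbove l)) := by
  -- After multiplication by `(-1) ^ k`, the two faces at the switch have opposite signs; their
  -- differences telescope in `h3`.
  have h1 : ∀ k : Fin (p + 1), D (splice u v s k.castSucc) - D (splice u v s k.succ) +
      ∑ i : Fin p, -((-1 : ℂ) ^ (k.succAbove i : ℕ) * ((-1) ^ (i.predAbove k : ℕ) *
        D (prism u v (i.predAbove k) fun l => s ((k.succAbove i).succAbove l)))) = 0 := by
    intro k
    have h2 : ((-1 : ℂ) ^ (k : ℕ) * (-1) ^ (k : ℕ)) = 1 := by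
      rw [← mul_pow]
      simp
    have h := congrArg ((-1 : ℂ) ^ (k : ℕ) * ·) (hD k)
    simp only [mul_zero] at h
    rw [Fin.sum_univ_succAbove _ k.castSucc, Fin.sum_univ_succAbove _ k,
      Fin.succAbove_castSucc_self, prism_succAbove_castSucc, prism_succAbove_succ, mul_add, mul_add,
      Finset.mul_sum, Fin.val_castSucc, Fin.val_succ, ← mul_assoc, h2, pow_succ, ← mul_assoc,
      ← mul_assoc, h2, ← add_assoc] at h
    convert h using 2
    · ring
    · refine Finset.sum_congr rfl fun i _ => ?_
      rw [prism_succAbove_succAbove, ← mul_assoc, ← mul_assoc, neg_one_pow_omitSwap, neg_mul]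
  have h3 : ∑ k : Fin (p + 1), (D (splice u v s k.castSucc) - D (splice u v s k.succ)) =
      D (fun i => v (s i)) - D (fun i => u (s i)) := by
    have e1 := Fin.sum_univ_castSucc fun t => D (splice u v s t)
    have e2 := Fin.sum_univ_succ fun t => D (splice u v s t)
    have e3 : splice u v s 0 = fun i => v (s i) := by
      ext i
      simp [splice]
    have e4 : splice u v s (Fin.last (p + 1)) = fun i => u (s i) := by
      ext i
      simp [splice, Fin.castSucc_lt_last]
    rw [e4] at e1
    rw [e3] at e2
    rw [Finset.sum_sub_distrib]
    linear_combination e2 - e1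
  have h4 := Finset.sum_eq_zero fun k (_ : k ∈ Finset.univ) => h1 k
  rw [Finset.sum_add_distrib, h3] at h4
  simp only [Finset.sum_neg_distrib] at h4
  rw [← sub_eq_add_neg, sub_eq_zero] at h4
  rw [h4]
  simp only [Finset.mul_sum]
  rw [← Fintype.sum_prod_type', ← Fintype.sum_prod_type']
  -- The outer faces are reindexed by the face of `s` and the position of the switch.
  exact (omitSwap p).sum_comp fun x : Fin (p + 1) × Fin p => (-1 : ℂ) ^ (x.1 : ℕ) *
    ((-1) ^ (x.2 : ℕ) * D (prism u v x.2 fun l => s (x.1.succAbove l)))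

end Prism

/-! ### The transformation law -/

/-- The determinants of `n` out of `n + 1` vectors in an affine hyperplane missing `0` have
alternating sum `0`. -/
theorem sum_neg_one_pow_mul_det_eq_zero {n : ℕ} (w : Fin (n + 1) → Fin n → ℂ) (a : Fin n → ℂ)
    (hw : ∀ k, ∑ l, w k l * a l = 1) :
    ∑ k : Fin (n + 1), (-1 : ℂ) ^ (k : ℕ) *
      (Matrix.of fun j : Fin n => w (k.succAbove j)).det = 0 := by
  -- Bordered by a column of ones, the vectors give a singular matrix, with `(1, -a)` in its kernel.
  -- Expansion along that column is the alternating sum.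
  set M : Matrix (Fin (n + 1)) (Fin (n + 1)) ℂ := Matrix.of fun k => Fin.cons 1 (w k)
  have hM : M.det = 0 := by
    refine Matrix.exists_mulVec_eq_zero_iff.1 ⟨Fin.cons 1 (-a), fun h => ?_, ?_⟩
    · simpa using congrFun h 0
    · ext k
      simp [M, Matrix.mulVec, dotProduct, Fin.sum_univ_succ, hw]
  rw [Matrix.det_succ_column_zero] at hM
  rw [← hM]
  refine Finset.sum_congr rfl fun k _ => ?_
  simp [M]
  congr 1

theorem differentiableOn_det {E : Type*} [NormedAddCommGroup E] [NormedSpace ℂ E] {n : ℕ}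
    {S : Set E} {M : E → Fin n → Fin n → ℂ} (hM : ∀ i j, DifferentiableOn ℂ (fun z => M z i j) S) :
    DifferentiableOn ℂ (fun z => (Matrix.of (M z)).det) S := by
  simp only [Matrix.det_apply']
  refine DifferentiableOn.fun_sum fun σ _ => DifferentiableOn.const_mul ?_ _
  exact fun z hz => (HasFDerivWithinAt.finsetProd fun i _ =>
    (hM (σ i) i z hz).hasFDerivWithinAt).differentiableWithinAt

theorem formCochain_eq_det {m : ℕ} (h : (Fin m → ℂ) → ℂ) (a : Fin m → (Fin m → ℂ) → ℂ)
    (s : Fin m → Fin m) (z : Fin m → ℂ) : formCochain h a s z =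
      h z * (Matrix.of fun k l => (a l z)⁻¹ * if s k = l then (1 : ℂ) else 0).det := by
  have := Matrix.det_mul_row (fun l => (a l z)⁻¹)
    (Matrix.of fun k l : Fin m => if s k = l then (1 : ℂ) else 0)
  simp only [Matrix.of_apply] at this
  rw [this, formCochain, coeff, Finset.prod_inv_distrib]
  ring

/-- If powers of the coordinates are combinations of the `aⱼ`, then the class of the residue form
is represented by a cocycle for the cover `{zᵢ ≠ 0}`. -/
theorem exists_cocycle {p : ℕ} {δ : ℝ} {h : (Fin (p + 1) → ℂ) → ℂ}
    {a : Fin (p + 1) → (Fin (p + 1) → ℂ) → ℂ} (hh : DifferentiableOn ℂ h (ball 0 δ))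
    (ha : ∀ i, DifferentiableOn ℂ (a i) (ball 0 δ)) {N : Fin (p + 1) → ℕ}
    {c : Fin (p + 1) → Fin (p + 1) → (Fin (p + 1) → ℂ) → ℂ}
    (hc : ∀ i l, DifferentiableOn ℂ (c i l) (ball 0 δ))
    (hN : ∀ z ∈ ball (0 : Fin (p + 1) → ℂ) δ, ∀ i, z i ^ N i = ∑ l, c i l z * a l z) :
    ∃ β, IsCechCocycle (ball 0 δ) (coordCover (p + 1)) β ∧
      CechCohomologous (ball 0 δ) (denCover a) (coordCover (p + 1)) (formCochain h a) β := by
  -- For each cover, a vector attached to every index and pairing to `1` with `(a₁, …, aₙ)`.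
  -- Determinants of the `v` give the form cochain (`formCochain_eq_det`), those of the `u` give
  -- `β`; the common hyperplane makes mixed determinants satisfy the same identity.
  set u : (Fin (p + 1) → ℂ) → Fin (p + 1) → Fin (p + 1) → ℂ :=
    fun z j l => (z j ^ N j)⁻¹ * c j l z with hu
  set v : (Fin (p + 1) → ℂ) → Fin (p + 1) → Fin (p + 1) → ℂ :=
    fun z i l => (a l z)⁻¹ * if i = l then (1 : ℂ) else 0 with hv
  have hu1 : ∀ z ∈ ball (0 : Fin (p + 1) → ℂ) δ, ∀ j, z j ≠ 0 → ∑ l, u z j l * a l z = 1 := by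
    intro z hz j hj
    simp only [hu, mul_assoc]
    rw [← Finset.mul_sum, ← hN z hz j, inv_mul_cancel₀ (pow_ne_zero _ hj)]
  have hv1 : ∀ z i, a i z ≠ 0 → ∑ l, v z i l * a l z = 1 := by
    intro z i hi
    simp [hv, hi]
  have hud : ∀ S ⊆ ball (0 : Fin (p + 1) → ℂ) δ, ∀ j l, (∀ z ∈ S, z j ≠ 0) →
      DifferentiableOn ℂ (fun z => u z j l) S := by
    intro S hS j l hj
    refine DifferentiableOn.mul ?_ ((hc j l).mono hS)
    exact DifferentiableOn.inv (by fun_prop) fun z hz => pow_ne_zero _ (hj z hz)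
  have hvd : ∀ S ⊆ ball (0 : Fin (p + 1) → ℂ) δ, ∀ i l, (∀ z ∈ S, a i z ≠ 0) →
      DifferentiableOn ℂ (fun z => v z i l) S := by
    intro S hS i l hi
    by_cases hil : i = l
    · subst hil
      simp only [hv, if_true, mul_one]
      exact DifferentiableOn.inv ((ha i).mono hS) hi
    · simp only [hv, hil, if_false, mul_zero]
      exact differentiableOn_const 0
  refine ⟨fun s z => h z * (Matrix.of fun k => u z (s k)).det, ⟨fun s => ?_, fun s z hz => ?_⟩, ?_⟩
  · have hS : cechInter (ball 0 δ) (coordCover (p + 1)) s ⊆ ball 0 δ := fun z hz => hz.1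
    exact (hh.mono hS).mul (differentiableOn_det fun k l => hud _ hS _ _ fun z hz => hz.2 k)
  · have := sum_neg_one_pow_mul_det_eq_zero (fun k => u z (s k)) (fun l => a l z)
      fun k => hu1 z hz.1 _ (hz.2 k)
    simp only [cechD, mul_left_comm _ (h z)]
    rw [← Finset.mul_sum, this, mul_zero]
  -- The connecting cochain is the prism operator, mixing rows `u` from the coordinate cover with
  -- rows `v` from the denominator cover.
  · refine ⟨fun q z => h z * ∑ k : Fin p, (-1 : ℂ) ^ (k : ℕ) *
      (Matrix.of (prism (fun x : Fin (p + 1) × Fin (p + 1) => u z x.2) (fun x => v z x.1) k q)).det,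
      fun q => ?_, fun s z hz => ?_⟩
    · set S := cechInter (ball 0 δ) (fun x => denCover a x.1 ∩ coordCover (p + 1) x.2) q
      have hS : S ⊆ ball 0 δ := fun z hz => hz.1
      refine (hh.mono hS).mul (DifferentiableOn.fun_sum fun k _ => DifferentiableOn.const_mul
        (differentiableOn_det fun i l => ?_) _)
      simp only [prism]
      split_ifs
      · exact hud S hS _ _ fun z hz => (hz.2 _).2
      · exact hvd S hS _ _ fun z hz => (hz.2 _).1
    · have := sub_eq_sum_prism (D := fun w => (Matrix.of w).det)
        (u := fun x : Fin (p + 1) × Fin (p + 1) => u z x.2) (v := fun x => v z x.1) s fun k =>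
          sum_neg_one_pow_mul_det_eq_zero _ (fun l => a l z) fun i => by
            simp only [prism]
            split_ifs
            · exact hu1 z hz.1 _ (hz.2 _).2
            · exact hv1 z _ (hz.2 _).1
      rw [formCochain_eq_det, ← mul_sub]
      simp only [cechD, mul_left_comm _ (h z)]
      rw [← Finset.mul_sum, ← this]

/-! ### Residues of flaglike forms -/

/-- The coordinates are themselves a flag system, for which all positive radii are flag radii.
Applied to `β`, this shows that its torus integral does not depend on the radii. -/
theorem isFlagSystem_coord (m : ℕ) (δ : ℝ) :
    IsFlagSystem δ fun (i : Fin m) (z : Fin m → ℂ) => z i where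
  differentiableOn i := by fun_prop
  eq_of_eq i z _ w _ h := h i le_rfl
  ne_zero i t ht _ := by simpa using ht

theorem isFlagRadii_coord {m : ℕ} {R : Fin m → ℝ} (hR : ∀ i, 0 < R i) :
    IsFlagRadii (fun i z => z i) R where
  pos := hR
  ne_zero z _ i hi := by
    rw [← norm_pos_iff, hi]
    exact hR i

/-- The polydisc in `IsLocalResidue` is not under control, so the radii are chosen inside both it
and the one carrying the flag system. The right side does not mention `β`, whence uniqueness. -/
theorem IsLocalResidue.eq_iteratedResidue {p : ℕ} {h : (Fin (p + 1) → ℂ) → ℂ}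
    {a : Fin (p + 1) → (Fin (p + 1) → ℂ) → ℂ} {ρ : ℂ} (hρ : IsLocalResidue h a ρ) {δ : ℝ}
    (hδ : 0 < δ) (ha : IsFlagSystem δ a) : ρ = iteratedResidue (p + 1) (coeff h a) := by
  obtain ⟨δ', hδ', hh, hd, -, β, -, hβ, hint⟩ := hρ
  have hm : 0 < min δ δ' := lt_min hδ hδ'
  have ham := ha.mono (min_le_left δ δ')
  obtain ⟨R, hR, hRm⟩ := ham.exists_isFlagRadii hm
  have hRδ' : ∀ i, R i < δ' := fun i => (hRm i).trans_le (min_le_right _ _)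
  rw [hint R fun i => ⟨hR.pos i, hRδ' i⟩,
    torusIntegral_eq_of_cechCohomologous hδ' hh hd hβ hR hRδ',
    ham.iteratedResidue_eq hm (differentiableOn_coeff
      (hh.mono (ball_subset_ball (min_le_right _ _))) ham.differentiableOn) hR hRm]

/-- A flaglike residue form, restricted to a small polydisc. -/
theorem IsResidueForm.exists_isFlagSystem {m : ℕ} {h : (Fin m → ℂ) → ℂ}
    {a : Fin m → (Fin m → ℂ) → ℂ} (hform : IsResidueForm h a) (hflag : IsFlaglike a)
    {P : (Fin m → ℂ) → Prop} (hP : ∀ᶠ z in 𝓝 0, P z) :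
    ∃ δ > 0, IsFlagSystem δ a ∧ DifferentiableOn ℂ h (ball 0 δ) ∧
      (∀ z ∈ ball (0 : Fin m → ℂ) δ, (∀ i, a i z = 0) ↔ z = 0) ∧ ∀ z ∈ ball 0 δ, P z := by
  have hne := eventually_single_ne_zero hform.analyticAt_den hform.den_zero hform.isolated hflag
  obtain ⟨δ₁, hδ₁, hf⟩ := hflag.exists_radius
  obtain ⟨δ₂, hδ₂, hn⟩ := Metric.eventually_nhds_iff_ball.1
    (eventually_nhdsWithin_iff.1 (eventually_all.2 hne))
  have hd : ∀ᶠ z in 𝓝 0, ∀ i, DifferentiableAt ℂ (a i) z := eventually_all.2 fun i =>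
    (hform.analyticAt_den i).eventually_analyticAt.mono fun z hz => hz.differentiableAt
  have hh : ∀ᶠ z in 𝓝 0, DifferentiableAt ℂ h z :=
    hform.analyticAt_num.eventually_analyticAt.mono fun z hz => hz.differentiableAt
  obtain ⟨δ₃, hδ₃, hev⟩ := Metric.eventually_nhds_iff_ball.1
    (hP.and (hd.and (hh.and (eventually_nhdsWithin_iff.1 hform.isolated))))
  refine ⟨min δ₁ (min δ₂ δ₃), lt_min hδ₁ (lt_min hδ₂ hδ₃), ?_⟩
  have h1 : ball (0 : Fin m → ℂ) (min δ₁ (min δ₂ δ₃)) ⊆ ball 0 δ₁ :=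
    ball_subset_ball (min_le_left _ _)
  have h3 : ball (0 : Fin m → ℂ) (min δ₁ (min δ₂ δ₃)) ⊆ ball 0 δ₃ :=
    ball_subset_ball ((min_le_right _ _).trans (min_le_right _ _))
  refine ⟨⟨fun i z hz => ((hev z (h3 hz)).2.1 i).differentiableWithinAt,
    fun i z hz w hw => hf i z (h1 hz) w (h1 hw), fun i t ht htδ => hn t ?_ ht i⟩,
    fun z hz => (hev z (h3 hz)).2.2.1.differentiableWithinAt, fun z hz => ⟨fun h0 => ?_, ?_⟩,
    fun z hz => (hev z (h3 hz)).1⟩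
  · exact mem_ball_zero_iff.2 (htδ.trans_le ((min_le_right _ _).trans (min_le_left _ _)))
  · by_contra hz0
    obtain ⟨i, hi⟩ := (hev z (h3 hz)).2.2.2 hz0
    exact hi (h0 i)
  · rintro rfl
    exact hform.den_zero

theorem IsResidueForm.exists_isLocalResidue {p : ℕ} {h : (Fin (p + 1) → ℂ) → ℂ}
    {a : Fin (p + 1) → (Fin (p + 1) → ℂ) → ℂ} (hform : IsResidueForm h a)
    (hflag : IsFlaglike a) : ∃ ρ, IsLocalResidue h a ρ := by
  obtain ⟨N, c, hev⟩ := exists_pow_eq_sum hform.analyticAt_den hflag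
    (eventually_single_ne_zero hform.analyticAt_den hform.den_zero hform.isolated hflag)
  obtain ⟨δ, hδ, ha, hh, hz, hc⟩ := hform.exists_isFlagSystem hflag hev
  obtain ⟨β, hβ, hcoh⟩ := exists_cocycle hh ha.differentiableOn
    (fun i l z hz => ((hc z hz).1 i l).differentiableWithinAt) fun z hz => (hc z hz).2
  -- The iterated residue of `β` itself serves as the value common to all radii.
  refine ⟨iteratedResidue (p + 1) (β id), δ, hδ, hh, ha.differentiableOn, hz, β, hβ, hcoh,
    fun R hR => ?_⟩
  exact (isFlagSystem_coord (p + 1) δ).iteratedResidue_eq hδ (hβ.1 id)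
    (isFlagRadii_coord fun i => (hR i).1) fun i => (hR i).2

end ResidueForm

end

theorem lemma3p2 (p : ℕ) (h : (Fin (p + 1) → ℂ) → ℂ)
    (a : Fin (p + 1) → (Fin (p + 1) → ℂ) → ℂ)
    (hform : ResidueForm.IsResidueForm h a) (hflag : ResidueForm.IsFlaglike a) :
    (∃! ρ : ℂ, ResidueForm.IsLocalResidue h a ρ) ∧
    ResidueForm.IteratedResidueExists (p + 1) (ResidueForm.coeff h a) ∧
    ResidueForm.localResidue h a =
      ResidueForm.iteratedResidue (p + 1) (ResidueForm.coeff h a) := by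
  obtain ⟨δ, hδ, ha, hh, -⟩ := hform.exists_isFlagSystem hflag (P := fun _ => True)
    (Eventually.of_forall fun _ => trivial)
  obtain ⟨ρ, hρ⟩ := hform.exists_isLocalResidue hflag
  refine ⟨⟨ρ, hρ, fun ρ' hρ' => ?_⟩, ?_, ?_⟩
  · rw [hρ'.eq_iteratedResidue hδ ha, hρ.eq_iteratedResidue hδ ha]
  · exact ha.iteratedResidueExists hδ (ResidueForm.differentiableOn_coeff hh ha.differentiableOn)
  · exact (Classical.epsilon_spec ⟨ρ, hρ⟩ :
      ResidueForm.IsLocalResidue h a _).eq_iteratedResidue hδ ha
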